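/- Let $(X,d)$ be a metric space. A dominating tree for $X$ is a tree $T$ with positive edge weights and $X\subseteq V(T)$ (further vertices are allowed) whose path metric $d_T$ satisfies $d_T(x,y)\ge d(x,y)$ for all $x,y\in X$. A Ramsey tree cover of $X$ of size $k$ with distortion $\alpha$ is a collection of $k$ dominating trees $T_1,\dots,T_k$ such that for every $u\in X$ there is an index $i$ with $d_{T_i}(u,v)\le \alpha\, d(u,v)$ for all $v\in X$. Theorem. There are a universal constant $C>0$ and a deterministic algorithm which, given the distance matrix of any $n$-point metric space $(X,d)$ and any integer $k\ge 1$, constructs a Ramsey tree cover $T_1,\dots,T_k$ of $X$ of size $k$ with distortion $$C\cdot n^{1/k}\,(\log n)^{1-1/k},$$ in which every $T_i$ is an ultrametric on $X$, that is, $d_{T_i}(x,z)\le\max\{d_{T_i}(x,y),d_{T_i}(y,z)\}$ for all $x,y,z\in X$. Here an algorithm is a single finite program, independent of $X$, $n$ and $k$, that computes with natural numbers and exact real numbers (field operations and order tests, no constants other than natural numbers), and it halts on every such input; the trees are output as weighted adjacency matrices in which the points of $X$, in the order of the input matrix, are the first $n$ vertices. -/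

import Mathlib

/-! ### Edge-weighted trees and Ramsey tree covers -/

/-- An edge-weighted tree `T` with `X ⊆ V(T)`: the points of `X` are vertices through `point`,
and there may be further (Steiner) vertices. Weights are positive on the edges; the values of
`weight` outside the edge set play no role. -/
structure WeightedTree (X : Type*) where
  V : Type
  graph : SimpleGraph V
  isTree : graph.IsTree
  weight : Sym2 V → ℝ
  weight_pos : ∀ s ∈ graph.edgeSet, 0 < weight s
  point : X ↪ V

namespace WeightedTree

variable {X : Type*}

/-- The total weight of the unique path of the tree between two vertices. -/
noncomputable def vertexDist (T : WeightedTree X) (a b : T.V) : ℝ :=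
  ((T.isTree.existsUnique_path a b).choose.edges.map T.weight).sum

/-- The tree distance `d_T(x, y)` between two points of `X`. -/
noncomputable def treeDist (T : WeightedTree X) (x y : X) : ℝ :=
  T.vertexDist (T.point x) (T.point y)

/-- The tree distance restricted to `X` satisfies the strong triangle inequality. -/
def IsUltrametric (T : WeightedTree X) : Prop :=
  ∀ x y z : X, T.treeDist x z ≤ max (T.treeDist x y) (T.treeDist y z)

/-- The tree never shrinks a distance of `X`. -/
def Dominating [MetricSpace X] (T : WeightedTree X) : Prop :=
  ∀ x y : X, dist x y ≤ T.treeDist x y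

open Classical in
/-- The entry of the weighted adjacency matrix of `T`: the weight of the edge, or `0`
if there is no edge. -/
noncomputable def adjEntry (T : WeightedTree X) (a b : T.V) : ℝ :=
  if T.graph.Adj a b then T.weight s(a, b) else 0

/-- The square matrix `M` (a list of rows) is the weighted adjacency matrix of `T` for a numbering
`φ` of the vertices in which the `i`-th point `e i` of `X` has number `i`. -/
def IsAdjacencyMatrix {n : ℕ} (T : WeightedTree X) (e : Fin n ≃ X) (M : List (List ℝ)) : Prop :=
  ∃ φ : T.V ≃ Fin M.length,
    (∀ i : Fin n, (φ (T.point (e i)) : ℕ) = i) ∧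
    M = List.ofFn fun a => List.ofFn fun b => T.adjEntry (φ.symm a) (φ.symm b)

end WeightedTree

/-- `T 0, …, T (k - 1)` is a Ramsey `(α, k)`-tree cover of `X`: all trees are dominating, and each
point `u` has a home tree with distortion at most `α` for all pairs `u, v`. As the trees dominate,
this forces `1 ≤ α` as soon as `X` has two points. -/
def IsRamseyTreeCover {X : Type*} [MetricSpace X] {k : ℕ} (α : ℝ)
    (T : Fin k → WeightedTree X) : Prop :=
  (∀ t, (T t).Dominating) ∧ ∀ u : X, ∃ t, ∀ v : X, (T t).treeDist u v ≤ α * dist u v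

/-! ### Deterministic algorithms over the reals

A program is a finite piece of syntax that handles natural numbers, exact real numbers, truth
values, pairs and lists. It has the field operations and the order test on the reals, the only
constants being the natural numbers, and its control structures are composition, branching,
recursion along a number or a list, and unbounded `while` loops. So programs denote the partial
recursive functions over the ordered field of the reals, as for the Blum-Shub-Smale machine
without real constants, or the real RAM. -/

/-- Data types. -/
inductive Ty : Type
  | nat : Ty
  | real : Ty
  | bool : Ty
  | prod : Ty → Ty → Ty
  | list : Ty → Ty

/-- The values of a data type. -/
@[reducible] def Ty.Data : Ty → Type
  | .nat => ℕ
  | .real => ℝ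
  | .bool => Bool
  | .prod a b => a.Data × b.Data
  | .list a => List a.Data

/-- Programs with input of type `a` and output of type `b`. -/
inductive Prog : Ty → Ty → Type
  | id {a : Ty} : Prog a a
  | comp {a b c : Ty} : Prog b c → Prog a b → Prog a c
  | pair {a b c : Ty} : Prog a b → Prog a c → Prog a (.prod b c)
  | fst {a b : Ty} : Prog (.prod a b) a
  | snd {a b : Ty} : Prog (.prod a b) b
  | zero {a : Ty} : Prog a .nat
  | succ : Prog .nat .nat
  | natCast : Prog .nat .real
  | add : Prog (.prod .real .real) .real
  | sub : Prog (.prod .real .real) .real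
  | mul : Prog (.prod .real .real) .real
  | div : Prog (.prod .real .real) .real
  | lt : Prog (.prod .real .real) .bool
  | nil {a b : Ty} : Prog a (.list b)
  | cons {a : Ty} : Prog (.prod a (.list a)) (.list a)
  | branch {a b : Ty} : Prog a .bool → Prog a b → Prog a b → Prog a b
  | natRec {a b : Ty} :
      Prog a b → Prog (.prod a (.prod .nat b)) b → Prog (.prod a .nat) b
  | listRec {a b c : Ty} :
      Prog a b → Prog (.prod a (.prod c (.prod (.list c) b))) b → Prog (.prod a (.list c)) b
  | whileLoop {a : Ty} : Prog a .bool → Prog a a → Prog a a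

/-- The output of a program on an input; undefined if the program does not halt. -/
noncomputable def Prog.eval : {a b : Ty} → Prog a b → a.Data → Part b.Data
  | _, _, .id, x => Part.some x
  | _, _, .comp g f, x => (f.eval x).bind fun y => g.eval y
  | _, _, .pair f g, x => (f.eval x).bind fun y => (g.eval x).bind fun z => Part.some (y, z)
  | _, _, .fst, x => Part.some x.1
  | _, _, .snd, x => Part.some x.2
  | _, _, .zero, _ => Part.some (0 : ℕ)
  | _, _, .succ, x => Part.some (Nat.succ x)
  | _, _, .natCast, x => Part.some (Nat.cast x : ℝ)
  | _, _, .add, x => Part.some (x.1 + x.2 : ℝ)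
  | _, _, .sub, x => Part.some (x.1 - x.2 : ℝ)
  | _, _, .mul, x => Part.some (x.1 * x.2 : ℝ)
  | _, _, .div, x => Part.some (x.1 / x.2 : ℝ)
  | _, _, .lt, x => Part.some (@decide ((x.1 : ℝ) < x.2) (Classical.propDecidable _))
  | _, _, .nil, _ => Part.some []
  | _, _, .cons, x => Part.some (x.1 :: x.2)
  | _, _, .branch c f g, x =>
      (c.eval x).bind fun t => Bool.rec (g.eval x) (f.eval x) t
  | _, _, .natRec f g, x =>
      Nat.rec (f.eval x.1) (fun i r => r.bind fun y => g.eval (x.1, i, y)) x.2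
  | _, _, .listRec f g, x =>
      List.rec (f.eval x.1) (fun h l r => r.bind fun y => g.eval (x.1, h, l, y)) x.2
  | _, _, .whileLoop c f, x =>
      PFun.fix (fun y => (c.eval y).bind fun t =>
        Bool.rec (Part.some (Sum.inl y)) ((f.eval y).map Sum.inr) t) x

/-- The distance matrix (a list of rows) of the points `e 0, …, e (n - 1)`. -/
def distMatrix {X : Type*} [MetricSpace X] {n : ℕ} (e : Fin n ≃ X) : List (List ℝ) :=
  List.ofFn fun i => List.ofFn fun j => dist (e i) (e j)

/-! The argument has a combinatorial half, the existence of `k` good ultrametrics, and a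
computational half, a brute-force search for them; no efficiency is claimed.

Existence. For a set `S` of terminals, `exists_ultrametric_on` builds one dominating ultrametric by
recursive ball cutting. A ball around a well-chosen terminal is separated from the rest, every pair
across the cut gets the current diameter `D`, and the terminals in a thin annulus around the cut are
given up. A terminal outside the annulus is at distance at least `D / (16 L)` from the other side,
so its distortion is at most `16 L`. Averaging the logarithmic growth of the ball over `L`
concentric annuli (`exists_small_growth`) yields a cheap annulus. Since the inner part has at most
half the diameter, its density bound drops from `N` to the size of the initial ball, so the
logarithmic costs telescope over the recursion. In total at most `|S| log n / L` terminals are lost,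
and none if `|S| ≤ L`.

In `exists_ultrametric_cover` the lost terminals become the terminals of the next ultrametric. After
`k - 1` rounds at most `n (log n / L) ^ (k - 1)` remain. If this is at most `L`, the `k`-th round
loses nothing. Solving for `L` gives `n ^ (1 / k) (log n) ^ (1 - 1 / k)`, which
`exists_distortion_bound` rounds up.

Algorithm. The ultrametrics take their values among the distances of `X`, so they lie in a finite
set of matrices that can be listed. Whether a family is a Ramsey cover with distortion `16 L` is
decided by finitely many order tests. Trying `L = 0, 1, 2, …` finds a family at least as good as the
existence proof promises, without computing logarithms or roots. Each ultrametric is then written as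
its tree of clusters, whose distances reproduce it exactly (`clusterTree_treeDist`). -/

/-! ### Dominating ultrametrics and their gluing. -/

/-- `ρ` is an ultrametric on `Y` that dominates the metric, is bounded by `D` on `Y`, and takes its
values among the distances. -/
structure DominatingUltrametricOn {X : Type*} [MetricSpace X] (Y : Finset X) (D : ℝ)
    (ρ : X → X → ℝ) : Prop where
  self : ∀ x ∈ Y, ρ x x = 0
  symm : ∀ x ∈ Y, ∀ y ∈ Y, ρ x y = ρ y x
  ultra : ∀ x ∈ Y, ∀ y ∈ Y, ∀ z ∈ Y, ρ x z ≤ max (ρ x y) (ρ y z)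
  dom : ∀ x ∈ Y, ∀ y ∈ Y, dist x y ≤ ρ x y
  le : ∀ x ∈ Y, ∀ y ∈ Y, ρ x y ≤ D
  value : ∀ x ∈ Y, ∀ y ∈ Y, ∃ a b : X, ρ x y = dist a b

open Classical in
theorem DominatingUltrametricOn.uniform {X : Type*} [MetricSpace X] {Y : Finset X} {D : ℝ}
    (hD : 0 ≤ D) (hdiam : ∀ x ∈ Y, ∀ y ∈ Y, dist x y ≤ D) (hval : ∃ a b : X, D = dist a b) :
    DominatingUltrametricOn Y D (fun x y => if x = y then 0 else D) where
  self x _ := by simp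
  symm x _ y _ := by simp [eq_comm]
  ultra x _ y _ z _ := by
    by_cases h1 : x = z
    · simp only [h1, if_true]; split_ifs <;> simp [hD]
    · by_cases h2 : x = y
      · subst h2; simp [h1, hD]
      · simp [h1, h2]
  dom x hx y hy := by
    by_cases h : x = y
    · simp [h]
    · simpa [h] using hdiam x hx y hy
  le x _ y _ := by split_ifs <;> simp [hD]
  value x _ y _ := by
    by_cases h : x = y
    · exact ⟨x, x, by simp [h]⟩
    · simpa [h] using hval

open Classical in
-- A triangle that crosses the cut has `D` on two of its sides, and its third side is at most `D`
-- because neither part exceeds `D`; so only triangles inside one part need their own ultrametric.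
-- Only membership in `Y₁` is tested, hence `Y₂` matters merely as a set containing the rest of `Y`.
theorem DominatingUltrametricOn.glue {X : Type*} [MetricSpace X] {Y Y₁ Y₂ : Finset X}
    {D D₁ D₂ : ℝ} {ρ₁ ρ₂ : X → X → ℝ} (h₁ : DominatingUltrametricOn Y₁ D₁ ρ₁)
    (h₂ : DominatingUltrametricOn Y₂ D₂ ρ₂) (hD₁ : D₁ ≤ D) (hD₂ : D₂ ≤ D)
    (hY : ∀ y ∈ Y, y ∉ Y₁ → y ∈ Y₂)
    (hdiam : ∀ x ∈ Y, ∀ y ∈ Y, dist x y ≤ D) (hval : ∃ a b : X, D = dist a b) :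
    DominatingUltrametricOn Y D
      (fun x y => if x ∈ Y₁ then (if y ∈ Y₁ then ρ₁ x y else D)
        else if y ∈ Y₁ then D else ρ₂ x y) where
  self x hx := by
    by_cases h : x ∈ Y₁
    · simpa [h] using h₁.self x h
    · simpa [h] using h₂.self x (hY x hx h)
  symm x hx y hy := by
    by_cases h : x ∈ Y₁ <;> by_cases h' : y ∈ Y₁ <;> simp only [h, h', if_true, if_false]
    · exact h₁.symm x h y h'
    · exact h₂.symm x (hY x hx h) y (hY y hy h')
  ultra x hx y hy z hz := by
    have l₁ : ∀ u ∈ Y₁, ∀ v ∈ Y₁, ρ₁ u v ≤ D := fun u hu v hv => (h₁.le u hu v hv).trans hD₁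
    have l₂ : ∀ u ∈ Y₂, ∀ v ∈ Y₂, ρ₂ u v ≤ D := fun u hu v hv => (h₂.le u hu v hv).trans hD₂
    by_cases h : x ∈ Y₁ <;> by_cases h' : y ∈ Y₁ <;> by_cases h'' : z ∈ Y₁ <;>
      simp only [h, h', h'', if_true, if_false]
    · exact h₁.ultra x h y h' z h''
    · exact le_max_right _ _
    · exact le_max_of_le_left (l₁ x h z h'')
    · exact le_max_left _ _
    · exact le_max_left _ _
    · exact le_max_of_le_left (l₂ x (hY x hx h) z (hY z hz h''))
    · exact le_max_right _ _
    · exact h₂.ultra x (hY x hx h) y (hY y hy h') z (hY z hz h'')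
  dom x hx y hy := by
    by_cases h : x ∈ Y₁ <;> by_cases h' : y ∈ Y₁ <;> simp only [h, h', if_true, if_false]
    · exact h₁.dom x h y h'
    · exact hdiam x hx y hy
    · exact hdiam x hx y hy
    · exact h₂.dom x (hY x hx h) y (hY y hy h')
  le x hx y hy := by
    by_cases h : x ∈ Y₁ <;> by_cases h' : y ∈ Y₁ <;>
      simp only [h, h', if_true, if_false, le_refl]
    · exact (h₁.le x h y h').trans hD₁
    · exact (h₂.le x (hY x hx h) y (hY y hy h')).trans hD₂
  value x hx y hy := by
    by_cases h : x ∈ Y₁ <;> by_cases h' : y ∈ Y₁ <;> simp only [h, h', if_true, if_false]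
    · exact h₁.value x h y h'
    · exact hval
    · exact hval
    · exact h₂.value x (hY x hx h) y (hY y hy h')

/-! ### Ball growing. -/

/-- Among `L` consecutive growth steps of a counting function one is cheap, and one is empty as
soon as `L` is at least the final count. -/
theorem exists_small_growth (b : ℕ → ℕ) (hb : Monotone b) (h0 : 1 ≤ b 0) {L N : ℕ} (hL : 1 ≤ L)
    (hN : b L ≤ N) :
    ∃ j < L, ((b (j + 1) : ℝ) - b j) * L ≤ b (j + 1) * (Real.log N - Real.log (b 0)) ∧
      (b L ≤ L → b (j + 1) = b j) := by
  have hpos : ∀ i, (0 : ℝ) < b i := fun i => by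
    exact_mod_cast h0.trans (hb (Nat.zero_le i))
  have hbN : Real.log (b L) ≤ Real.log N :=
    Real.log_le_log (hpos L) (by exact_mod_cast hN)
  have hlog : Real.log (b 0) ≤ Real.log (b L) :=
    Real.log_le_log (hpos 0) (by exact_mod_cast hb (Nat.zero_le L))
  by_cases h : ∃ j < L, b (j + 1) = b j
  · obtain ⟨j, hj, e⟩ := h
    refine ⟨j, hj, ?_, fun _ => e⟩
    rw [e, sub_self, zero_mul]
    exact mul_nonneg (hpos j).le (by linarith)
  · push Not at h
    -- Without an empty step the count rises by at least one each time, so `b L ≥ L + 1`; this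
    -- refutes the premise `b L ≤ L` of the last claim.
    have hgrow : ∀ j ≤ L, b 0 + j ≤ b j := by
      intro j
      induction j with
      | zero => simp
      | succ j ih =>
        intro hj
        have := ih (by omega)
        have h1 := hb (Nat.le_succ j)
        have h2 := h j (by omega)
        simp only [Nat.succ_eq_add_one] at h1
        omega
    have hLL := hgrow L le_rfl
    have hLpos : (0 : ℝ) < L := by exact_mod_cast hL
    -- The increments of `log b` telescope to at most `log N - log (b 0)`, so one of the `L`
    -- increments is at most the average.
    obtain ⟨j, hj, hle⟩ := Finset.exists_le_of_sum_le (s := Finset.range L)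
      (f := fun j => Real.log (b (j + 1)) - Real.log (b j))
      (g := fun _ => (Real.log N - Real.log (b 0)) / L) (Finset.nonempty_range_iff.2 (by omega))
      (by
        rw [Finset.sum_range_sub (fun j => Real.log (b j)), Finset.sum_const, Finset.card_range,
          nsmul_eq_mul, mul_div_cancel₀ _ hLpos.ne']
        linarith)
    refine ⟨j, Finset.mem_range.1 hj, ?_, fun hc => by omega⟩
    -- `1 - 1 / t ≤ log t` at `t = b (j + 1) / b j` turns a small logarithmic increment into a small
    -- relative loss.
    have h1 := Real.one_sub_inv_le_log_of_pos (div_pos (hpos (j + 1)) (hpos j))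
    rw [Real.log_div (hpos _).ne' (hpos _).ne', inv_div] at h1
    have h2 := h1.trans hle
    rw [le_div_iff₀ hLpos] at h2
    have h3 := mul_le_mul_of_nonneg_left h2 (hpos (j + 1)).le
    have h4 : (b (j + 1) : ℝ) * ((1 - b j / b (j + 1)) * L) = ((b (j + 1) : ℝ) - b j) * L := by
      field_simp [(hpos (j + 1)).ne']
    linarith

open Classical in
/-- Ball growing: a dominating ultrametric with distortion `16 L` from all terminals but a few. -/
theorem exists_ultrametric_on {X : Type*} [MetricSpace X] {L : ℕ} (hL : 1 ≤ L) :
    ∀ (m : ℕ) (Y S : Finset X) (N : ℕ) (D : ℝ), Y.card ≤ m → S ⊆ Y →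
      (∀ x ∈ Y, ∀ y ∈ Y, dist x y ≤ D) → (∃ a ∈ Y, ∃ b ∈ Y, D = dist a b) →
      (∀ x ∈ S, (S.filter fun s => dist x s ≤ D / 4).card ≤ N) →
      ∃ (ρ : X → X → ℝ) (B : Finset X), DominatingUltrametricOn Y D ρ ∧ B ⊆ S ∧
        (B.card : ℝ) * L ≤ S.card * Real.log N ∧ (S.card ≤ L → B = ∅) ∧
        ∀ u ∈ S, u ∉ B → ∀ v ∈ Y, ρ u v ≤ 16 * L * dist u v := by
  intro m
  induction m with
  | zero =>
    intro Y S N D hm hS hdiam ⟨a, ha, _⟩ hN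
    have : Y = ∅ := Finset.card_eq_zero.1 (by omega)
    simp [this] at ha
  | succ m ih =>
    intro Y S N D hm hS hdiam hval hN
    obtain ⟨a₀, ha₀, b₀, hb₀, hD⟩ := hval
    have hD0 : 0 ≤ D := hD ▸ dist_nonneg
    rcases S.eq_empty_or_nonempty with hSe | hSne
    · exact ⟨_, ∅, .uniform hD0 hdiam ⟨a₀, b₀, hD⟩, by simp, by simp [hSe], by simp, by simp [hSe]⟩
    -- For `D = 0` the annuli would have no width; the zero function serves instead.
    rcases hD0.eq_or_lt with hDz | hDpos
    · refine ⟨_, ∅, .uniform hD0 hdiam ⟨a₀, b₀, hD⟩, by simp, ?_, by simp, ?_⟩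
      · have := Real.log_natCast_nonneg N
        simp only [Finset.card_empty, Nat.cast_zero, zero_mul]
        positivity
      · intro u _ _ v _
        have : (if u = v then 0 else D) = 0 := by split_ifs <;> simp [hDz]
        simp only [this]
        positivity
    have hLpos : (0 : ℝ) < L := by exact_mod_cast hL
    -- The densest centre at radius `D / 8` makes `b 0` a density bound for all terminals at that
    -- scale, which the recursion inside the ball inherits.
    obtain ⟨x, hxS, hmax⟩ := Finset.exists_max_image S
      (fun x => (S.filter fun s => dist x s ≤ D / 8).card) hSne
    -- The radii run from `D / 8` to `D / 4` in `L` equal steps.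
    set r : ℕ → ℝ := fun j => D / 8 + j * (D / (8 * L)) with hr
    set b : ℕ → ℕ := fun j => (S.filter fun s => dist x s ≤ r j).card with hb
    have hstep : 0 < D / (8 * L) := by positivity
    have hrmono : Monotone r := fun i j hij => by
      have : (i : ℝ) ≤ j := by exact_mod_cast hij
      simp only [hr]
      gcongr
    have hbmono : Monotone b := fun i j hij => Finset.card_le_card fun s hs => by
      rw [Finset.mem_filter] at hs ⊢
      exact ⟨hs.1, hs.2.trans (hrmono hij)⟩
    have hr0 : r 0 = D / 8 := by simp [hr]
    have hrL : r L = D / 4 := by simp only [hr]; field_simp; norm_num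
    have hb0 : 1 ≤ b 0 := by
      refine Finset.card_pos.2 ⟨x, ?_⟩
      rw [Finset.mem_filter]
      exact ⟨hxS, by rw [dist_self, hr0]; positivity⟩
    have hbL : b L ≤ N := by
      have := hN x hxS
      simp only [hb, hrL]; exact this
    obtain ⟨j, hjL, hcheap, hempty⟩ := exists_small_growth b hbmono hb0 hL hbL
    -- The cut runs through the middle of the chosen annulus, leaving a margin `D / (16 L)` on both
    -- sides.
    set c : ℝ := r j + D / (16 * L) with hc
    have hrc : r (j + 1) = c + D / (16 * L) := by
      simp only [hc, hr]; push_cast; field_simp; ring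
    have hhalf : 0 < D / (16 * L) := by positivity
    have hc4 : c ≤ D / 4 := by
      have := hrmono (show j + 1 ≤ L from hjL)
      linarith
    have hc0 : 0 ≤ c := by
      have := hrmono (Nat.zero_le j)
      rw [hr0] at this
      linarith
    set Y₁ := Y.filter fun y => dist x y ≤ c with hY₁
    set Y₂ := Y.filter fun y => ¬ dist x y ≤ c with hY₂
    set S₁ := S.filter fun s => dist x s ≤ r j with hS₁
    set S₂ := S.filter fun s => ¬ dist x s ≤ r (j + 1) with hS₂
    have hxY : x ∈ Y := hS hxS
    have hY₁sub : Y₁ ⊆ Y := Finset.filter_subset _ _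
    have hY₂sub : Y₂ ⊆ Y := Finset.filter_subset _ _
    have hxY₁ : x ∈ Y₁ := by simp [hY₁, hxY, hc0]
    have hd₁ : ∀ y ∈ Y₁, ∀ z ∈ Y₁, dist y z ≤ D / 2 := by
      intro y hy z hz
      have h1 := (Finset.mem_filter.1 hy).2
      have h2 := (Finset.mem_filter.1 hz).2
      have := dist_triangle_left y z x
      linarith
    have hcard₁ : Y₁.card ≤ m := by
      have : Y₁ ⊂ Y := by
        refine ⟨hY₁sub, fun hle => ?_⟩
        have := hd₁ a₀ (hle ha₀) b₀ (hle hb₀)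
        linarith
      have := Finset.card_lt_card this
      omega
    have hcard₂ : Y₂.card ≤ m := by
      have : Y₂ ⊂ Y := by
        refine ⟨hY₂sub, fun hle => ?_⟩
        exact (Finset.mem_filter.1 (hle hxY)).2 (Finset.mem_filter.1 hxY₁).2
      have := Finset.card_lt_card this
      omega
    have hdiamval : ∀ Z : Finset X, Z.Nonempty → ∃ D' : ℝ,
        (∀ y ∈ Z, ∀ z ∈ Z, dist y z ≤ D') ∧ ∃ a ∈ Z, ∃ b ∈ Z, D' = dist a b := by
      intro Z hZ
      obtain ⟨p, hp, hpm⟩ := Finset.exists_max_image (Z ×ˢ Z) (fun p => dist p.1 p.2)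
        (hZ.product hZ)
      rw [Finset.mem_product] at hp
      exact ⟨dist p.1 p.2, fun y hy z hz => hpm (y, z) (Finset.mem_product.2 ⟨hy, hz⟩),
        p.1, hp.1, p.2, hp.2, rfl⟩
    obtain ⟨D₁, hD₁, hD₁v⟩ := hdiamval Y₁ ⟨x, hxY₁⟩
    have hD₁le : D₁ ≤ D / 2 := by
      obtain ⟨p, hp, q, hq, e⟩ := hD₁v
      exact e ▸ hd₁ p hp q hq
    have hS₁sub : S₁ ⊆ Y₁ := by
      intro s hs
      rw [Finset.mem_filter] at hs ⊢
      exact ⟨hS hs.1, by linarith [hs.2]⟩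
    have hS₂sub : S₂ ⊆ Y₂ := by
      intro s hs
      rw [Finset.mem_filter] at hs ⊢
      exact ⟨hS hs.1, fun h => hs.2 (by linarith)⟩
    -- Since `D₁ ≤ D / 2`, the balls of radius `D₁ / 4` lie within radius `D / 8`, where maximality
    -- of `x` bounds the count by `b 0`. So the inner call may use `b 0` in place of `N`.
    obtain ⟨ρ₁, B₁, hρ₁, hB₁, hcount₁, hB₁e, hgood₁⟩ := ih Y₁ S₁ (b 0) D₁ hcard₁ hS₁sub hD₁ hD₁v
      (by
        intro y hy
        refine le_trans (Finset.card_le_card ?_) ((hmax y (Finset.mem_filter.1 hy).1).trans ?_)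
        · intro s hs
          rw [Finset.mem_filter] at hs ⊢
          exact ⟨(Finset.mem_filter.1 hs.1).1, by linarith [hs.2]⟩
        · simp only [hb, hr0, le_refl])
    -- The outer call keeps `N`. An empty `Y₂` is treated apart, since it has no pair attaining its
    -- diameter.
    have hpart₂ : ∃ (ρ₂ : X → X → ℝ) (B₂ : Finset X) (D₂ : ℝ), D₂ ≤ D ∧
        DominatingUltrametricOn Y₂ D₂ ρ₂ ∧ B₂ ⊆ S₂ ∧
        (B₂.card : ℝ) * L ≤ S₂.card * Real.log N ∧ (S₂.card ≤ L → B₂ = ∅) ∧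
        ∀ u ∈ S₂, u ∉ B₂ → ∀ v ∈ Y₂, ρ₂ u v ≤ 16 * L * dist u v := by
      rcases Y₂.eq_empty_or_nonempty with h2 | h2
      · have hS₂e : S₂ = ∅ := Finset.subset_empty.1 (h2 ▸ hS₂sub)
        refine ⟨fun _ _ => 0, ∅, D, le_rfl, ?_, by simp, by simp [hS₂e], by simp, by simp [hS₂e]⟩
        constructor <;> simp [h2]
      · obtain ⟨D₂, hD₂, hD₂v⟩ := hdiamval Y₂ h2
        have hD₂le : D₂ ≤ D := by
          obtain ⟨p, hp, q, hq, e⟩ := hD₂v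
          exact e ▸ hdiam p (hY₂sub hp) q (hY₂sub hq)
        obtain ⟨ρ₂, B₂, h⟩ := ih Y₂ S₂ N D₂ hcard₂ hS₂sub hD₂ hD₂v
          (by
            intro y hy
            refine le_trans (Finset.card_le_card ?_) (hN y (Finset.mem_filter.1 hy).1)
            intro s hs
            rw [Finset.mem_filter] at hs ⊢
            exact ⟨(Finset.mem_filter.1 hs.1).1, by linarith [hs.2]⟩)
        exact ⟨ρ₂, B₂, D₂, hD₂le, h⟩
    obtain ⟨ρ₂, B₂, D₂, hD₂le, hρ₂, hB₂, hcount₂, hB₂e, hgood₂⟩ := hpart₂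
    set S₀ := S.filter fun s => dist x s ≤ r (j + 1) ∧ ¬ dist x s ≤ r j with hS₀
    have hsplit₁ : (S₀.card : ℝ) + S₁.card = b (j + 1) := by
      have : S₁ ∪ S₀ = S.filter fun s => dist x s ≤ r (j + 1) := by
        ext s
        simp only [hS₁, hS₀, Finset.mem_union, Finset.mem_filter]
        have := hrmono (Nat.le_succ j)
        constructor
        · rintro (h | h)
          · exact ⟨h.1, h.2.trans this⟩
          · exact ⟨h.1, h.2.1⟩
        · rintro h
          by_cases h' : dist x s ≤ r j
          · exact Or.inl ⟨h.1, h'⟩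
          · exact Or.inr ⟨h.1, h.2, h'⟩
      have hdisj : Disjoint S₁ S₀ := by
        rw [Finset.disjoint_left]
        intro s hs hs'
        exact (Finset.mem_filter.1 hs').2.2 (Finset.mem_filter.1 hs).2
      have h := Finset.card_union_of_disjoint hdisj
      rw [this] at h
      simp only [hb, h]
      push_cast
      ring
    have hsplit₂ : (b (j + 1) : ℝ) + S₂.card = S.card := by
      exact_mod_cast Finset.card_filter_add_card_filter_not (s := S)
        (fun s => dist x s ≤ r (j + 1))
    have hbj : (b j : ℝ) = S₁.card := rfl
    have hlog0 : 0 ≤ Real.log (b 0) := Real.log_natCast_nonneg _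
    refine ⟨_, S₀ ∪ (B₁ ∪ B₂), hρ₁.glue hρ₂ (by linarith) hD₂le ?_ hdiam ⟨a₀, b₀, hD⟩, ?_, ?_,
      ?_, ?_⟩
    · intro y hy hy'
      rw [Finset.mem_filter] at hy' ⊢
      exact ⟨hy, fun h => hy' ⟨hy, h⟩⟩
    · refine Finset.union_subset (Finset.filter_subset _ _) (Finset.union_subset ?_ ?_)
      · exact hB₁.trans (Finset.filter_subset _ _)
      · exact hB₂.trans (Finset.filter_subset _ _)
    -- The charges are `(|S₀| + |S₁|)(log N - log (b 0))` for the annulus, `|S₁| log (b 0)` for the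
    -- inside and `|S₂| log N` for the outside. The terms `|S₁| log (b 0)` cancel, leaving at most
    -- `|S| log N`.
    · have h1 : ((S₀ ∪ (B₁ ∪ B₂)).card : ℝ) ≤ S₀.card + (B₁.card + B₂.card) := by
        have h1 := Finset.card_union_le S₀ (B₁ ∪ B₂)
        have h2 := Finset.card_union_le B₁ B₂
        exact_mod_cast h1.trans (by omega)
      have h2 : (S₀.card : ℝ) * L ≤ (S₀.card + S₁.card) * (Real.log N - Real.log (b 0)) := by
        rw [hsplit₁]
        have : (S₀.card : ℝ) = b (j + 1) - b j := by rw [hbj]; linarith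
        rw [this]
        exact hcheap
      have h3 : (S.card : ℝ) = S₀.card + S₁.card + S₂.card := by linarith
      have h4 := mul_le_mul_of_nonneg_right h1 hLpos.le
      have h5 : 0 ≤ (S₀.card : ℝ) * Real.log (b 0) := by positivity
      rw [h3]
      linarith
    · intro hSL
      have h1 : S₁.card ≤ L := (Finset.card_le_card (Finset.filter_subset _ _)).trans hSL
      have h2 : S₂.card ≤ L := (Finset.card_le_card (Finset.filter_subset _ _)).trans hSL
      have h3 : b (j + 1) = b j :=
        hempty ((Finset.card_le_card (Finset.filter_subset _ _)).trans hSL)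
      have h4 : S₀ = ∅ := by
        rw [← Finset.card_eq_zero]
        have : (S₀.card : ℝ) = 0 := by
          rw [h3, hbj] at hsplit₁
          linarith
        exact_mod_cast this
      simp [hB₁e h1, hB₂e h2, h4]
    · intro u hu hub v hv
      simp only [Finset.mem_union, not_or] at hub
      obtain ⟨hu0, hu1, hu2⟩ := hub
      -- A surviving terminal is at least the margin away from every point across the cut, so the
      -- value `D` is within the allowed distortion.
      have hfar : D / (16 * L) ≤ dist u v → D ≤ 16 * L * dist u v := by
        intro h
        rwa [div_le_iff₀' (by positivity)] at h
      by_cases hin : dist x u ≤ r j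
      · have huS₁ : u ∈ S₁ := Finset.mem_filter.2 ⟨hu, hin⟩
        have huY₁ : u ∈ Y₁ := hS₁sub huS₁
        rw [if_pos huY₁]
        by_cases hv1 : v ∈ Y₁
        · rw [if_pos hv1]
          exact hgood₁ u huS₁ hu1 v hv1
        · rw [if_neg hv1]
          apply hfar
          have : ¬ dist x v ≤ c := fun h => hv1 (Finset.mem_filter.2 ⟨hv, h⟩)
          have := dist_triangle x u v
          linarith
      · have hout : ¬ dist x u ≤ r (j + 1) := fun h =>
          hu0 (Finset.mem_filter.2 ⟨hu, h, hin⟩)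
        have huS₂ : u ∈ S₂ := Finset.mem_filter.2 ⟨hu, hout⟩
        have huY₂ : ¬ dist x u ≤ c := (Finset.mem_filter.1 (hS₂sub huS₂)).2
        have huY₁ : u ∉ Y₁ := fun h => huY₂ (Finset.mem_filter.1 h).2
        rw [if_neg huY₁]
        by_cases hv1 : v ∈ Y₁
        · rw [if_pos hv1]
          apply hfar
          have hvc := (Finset.mem_filter.1 hv1).2
          have := dist_triangle_right x u v
          linarith
        · rw [if_neg hv1]
          exact hgood₂ u huS₂ hu2 v
            (Finset.mem_filter.2 ⟨hv, fun h => hv1 (Finset.mem_filter.2 ⟨hv, h⟩)⟩)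

/-! ### Iteration over the lost terminals. -/

open Classical in
-- The recursion starts at the diameter of `X` with the trivial density bound `N = |X|`.
theorem exists_ultrametric_of_terminals {X : Type*} [MetricSpace X] [Fintype X] [Nonempty X]
    {L : ℕ} (hL : 1 ≤ L) (S : Finset X) :
    ∃ (ρ : X → X → ℝ) (B : Finset X), (∃ D, DominatingUltrametricOn Finset.univ D ρ) ∧
      (B.card : ℝ) * L ≤ S.card * Real.log (Fintype.card X) ∧ (S.card ≤ L → B = ∅) ∧
      ∀ u ∈ S, u ∉ B → ∀ v, ρ u v ≤ 16 * L * dist u v := by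
  obtain ⟨p, hp⟩ := Finite.exists_max (fun p : X × X => dist p.1 p.2)
  obtain ⟨ρ, B, h1, -, h2, h3, h4⟩ := exists_ultrametric_on hL _ Finset.univ S (Fintype.card X)
    (dist p.1 p.2) le_rfl (Finset.subset_univ _) (fun x _ y _ => hp (x, y))
    ⟨p.1, Finset.mem_univ _, p.2, Finset.mem_univ _, rfl⟩ (fun x _ => Finset.card_le_univ _)
  exact ⟨ρ, B, ⟨_, h1⟩, h2, h3, fun u hu hb v => h4 u hu hb v (Finset.mem_univ _)⟩

/-- Every finite metric space has a Ramsey cover by `k` dominating ultrametrics with distortion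
`16 L` as soon as `n (log n) ^ (k - 1) ≤ L ^ k`. -/
theorem exists_ultrametric_cover {X : Type*} [MetricSpace X] [Fintype X] {L : ℕ} (hL : 1 ≤ L) :
    ∀ (k : ℕ) (S : Finset X),
      (S.card : ℝ) * Real.log (Fintype.card X) ^ k ≤ (L : ℝ) ^ (k + 1) →
      ∃ ρ : Fin (k + 1) → X → X → ℝ, (∀ t, ∃ D, DominatingUltrametricOn Finset.univ D (ρ t)) ∧
        ∀ u ∈ S, ∃ t, ∀ v, ρ t u v ≤ 16 * L * dist u v := by
  intro k
  have hLpos : (0 : ℝ) < L := by exact_mod_cast hL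
  rcases isEmpty_or_nonempty X with hX | hX
  · intro S _
    exact ⟨fun _ _ _ => 0, fun _ => ⟨0, by constructor <;> intro x <;> exact hX.elim x⟩,
      fun u => hX.elim u⟩
  induction k with
  | zero =>
    intro S hS
    obtain ⟨ρ, B, h1, -, h3, h4⟩ := exists_ultrametric_of_terminals hL S
    -- With one ultrametric left the hypothesis reads `|S| ≤ L`, so no terminal is lost.
    have hB : B = ∅ := h3 (by simpa using hS)
    exact ⟨fun _ => ρ, fun _ => h1, fun u hu => ⟨0, h4 u hu (by simp [hB])⟩⟩
  | succ k ih =>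
    intro S hS
    obtain ⟨ρ, B, h1, h2, -, h4⟩ := exists_ultrametric_of_terminals hL S
    have hlog := Real.log_natCast_nonneg (Fintype.card X)
    -- Each round trades a factor `log n` for a factor `L`, which preserves the hypothesis for the
    -- lost set `B`.
    obtain ⟨σ, hσ, hcov⟩ := ih B (by
      have h := mul_le_mul_of_nonneg_right h2 (pow_nonneg hlog k)
      have h' : (B.card : ℝ) * Real.log (Fintype.card X) ^ k * L ≤ (L : ℝ) ^ (k + 1) * L := by
        calc _ = (B.card : ℝ) * L * Real.log (Fintype.card X) ^ k := by ring
          _ ≤ _ := h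
          _ = S.card * Real.log (Fintype.card X) ^ (k + 1) := by ring
          _ ≤ _ := hS
          _ = _ := by ring
      exact le_of_mul_le_mul_right h' hLpos)
    refine ⟨Fin.cons ρ σ, ?_, ?_⟩
    · intro t
      refine Fin.cases ?_ ?_ t
      · simpa using h1
      · intro i; simpa using hσ i
    · intro u hu
      by_cases hub : u ∈ B
      · obtain ⟨t, ht⟩ := hcov u hub
        exact ⟨t.succ, by simpa using ht⟩
      · exact ⟨0, by simpa using h4 u hu hub⟩

/-! ### Closure properties of the computable total functions. -/

/-- The total function `f` is computed by some program. -/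
def Computes {a b : Ty} (f : a.Data → b.Data) : Prop :=
  ∃ P : Prog a b, ∀ x, P.eval x = Part.some (f x)

namespace Computes

variable {a b c : Ty}

theorem id : Computes (a := a) (b := a) fun x => x := ⟨.id, fun x => by simp [Prog.eval]⟩

theorem comp {g : b.Data → c.Data} {f : a.Data → b.Data} (hg : Computes g) (hf : Computes f) :
    Computes fun x => g (f x) := by
  obtain ⟨P, hP⟩ := hg
  obtain ⟨Q, hQ⟩ := hf
  exact ⟨.comp P Q, fun x => by simp [Prog.eval, hP, hQ]⟩

theorem pair {f : a.Data → b.Data} {g : a.Data → c.Data} (hf : Computes f) (hg : Computes g) :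
    Computes (a := a) (b := .prod b c) fun x => (f x, g x) := by
  obtain ⟨P, hP⟩ := hf
  obtain ⟨Q, hQ⟩ := hg
  exact ⟨.pair P Q, fun x => by simp [Prog.eval, hP, hQ]⟩

theorem fst {f : a.Data → (Ty.prod b c).Data} (hf : Computes f) :
    Computes (a := a) (b := b) fun x => (f x).1 :=
  comp (b := .prod b c) (g := fun p => p.1) ⟨.fst, fun x => by simp [Prog.eval]⟩ hf

theorem snd {f : a.Data → (Ty.prod b c).Data} (hf : Computes f) :
    Computes (a := a) (b := c) fun x => (f x).2 :=
  comp (b := .prod b c) (g := fun p => p.2) ⟨.snd, fun x => by simp [Prog.eval]⟩ hf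

theorem zero : Computes (a := a) (b := .nat) fun _ => (0 : ℕ) :=
  ⟨.zero, fun x => by simp [Prog.eval]⟩

theorem succ {f : a.Data → ℕ} (hf : Computes (a := a) (b := .nat) f) :
    Computes (a := a) (b := .nat) fun x => f x + 1 :=
  comp (b := .nat) (c := .nat) (g := fun n : ℕ => n + 1)
    ⟨.succ, fun x => by simp [Prog.eval]⟩ hf

theorem const_nat (n : ℕ) : Computes (a := a) (b := .nat) fun _ => n := by
  induction n with
  | zero => exact zero
  | succ n ih => exact succ ih

theorem natCast {f : a.Data → ℕ} (hf : Computes (a := a) (b := .nat) f) :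
    Computes (a := a) (b := .real) fun x => (f x : ℝ) :=
  comp (b := .nat) (c := .real) (g := fun n : ℕ => (n : ℝ))
    ⟨.natCast, fun x => by simp [Prog.eval]⟩ hf

section Real

variable {f g : a.Data → ℝ}

theorem sub (hf : Computes (a := a) (b := .real) f) (hg : Computes (a := a) (b := .real) g) :
    Computes (a := a) (b := .real) fun x => f x - g x :=
  comp (b := .prod .real .real) (c := .real) (g := fun p : ℝ × ℝ => p.1 - p.2)
    ⟨.sub, fun x => by simp [Prog.eval]⟩ (pair hf hg)

theorem mul (hf : Computes (a := a) (b := .real) f) (hg : Computes (a := a) (b := .real) g) :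
    Computes (a := a) (b := .real) fun x => f x * g x :=
  comp (b := .prod .real .real) (c := .real) (g := fun p : ℝ × ℝ => p.1 * p.2)
    ⟨.mul, fun x => by simp [Prog.eval]⟩ (pair hf hg)

theorem div (hf : Computes (a := a) (b := .real) f) (hg : Computes (a := a) (b := .real) g) :
    Computes (a := a) (b := .real) fun x => f x / g x :=
  comp (b := .prod .real .real) (c := .real) (g := fun p : ℝ × ℝ => p.1 / p.2)
    ⟨.div, fun x => by simp [Prog.eval]⟩ (pair hf hg)

end Real

end Computes

/-- The order test on the reals. -/
noncomputable def realLt (x y : ℝ) : Bool := @decide (x < y) (Classical.propDecidable _)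

/-- The order test on the reals, weak version. -/
noncomputable def realLe (x y : ℝ) : Bool := !realLt y x

/-- The order test on the natural numbers, by way of the reals. -/
noncomputable def natLt (m n : ℕ) : Bool := realLt m n

/-- The equality test on the natural numbers, by way of the reals. -/
noncomputable def natEq (m n : ℕ) : Bool := !natLt m n && !natLt n m

@[simp] theorem realLt_eq_true {x y : ℝ} : realLt x y = true ↔ x < y := by simp [realLt]

@[simp] theorem realLe_eq_true {x y : ℝ} : realLe x y = true ↔ x ≤ y := by
  simp [realLe, realLt]

@[simp] theorem natLt_eq_true {m n : ℕ} : natLt m n = true ↔ m < n := by simp [natLt]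

@[simp] theorem natEq_eq_true {m n : ℕ} : natEq m n = true ↔ m = n := by
  simp [natEq, natLt, realLt]
  omega

namespace Computes

variable {a b c : Ty}

theorem realLt {f g : a.Data → ℝ} (hf : Computes (a := a) (b := .real) f)
    (hg : Computes (a := a) (b := .real) g) :
    Computes (a := a) (b := .bool) fun x => realLt (f x) (g x) :=
  comp (b := .prod .real .real) (c := .bool) (g := fun p : ℝ × ℝ => _root_.realLt p.1 p.2)
    ⟨.lt, fun x => by simp [Prog.eval, _root_.realLt]⟩ (pair hf hg)

theorem natLt {f g : a.Data → ℕ} (hf : Computes (a := a) (b := .nat) f)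
    (hg : Computes (a := a) (b := .nat) g) :
    Computes (a := a) (b := .bool) fun x => natLt (f x) (g x) :=
  realLt (natCast hf) (natCast hg)

theorem cond {t : a.Data → Bool} {f g : a.Data → b.Data}
    (ht : Computes (a := a) (b := .bool) t) (hf : Computes f) (hg : Computes g) :
    Computes (a := a) (b := b) fun x => bif t x then f x else g x := by
  obtain ⟨P, hP⟩ := ht
  obtain ⟨Q, hQ⟩ := hf
  obtain ⟨R, hR⟩ := hg
  refine ⟨.branch P Q R, fun x => ?_⟩
  simp only [Prog.eval, hP, hQ, hR, Part.bind_some]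
  cases t x <;> rfl

/-- Programs have no truth constants; they arise from comparing the numerals `0` and `1`. -/
theorem const_bool (t : Bool) : Computes (a := a) (b := .bool) fun _ => t := by
  have h : ∀ m n : ℕ, Computes (a := a) (b := .bool) fun _ => _root_.natLt m n :=
    fun m n => natLt (const_nat m) (const_nat n)
  cases t with
  | true => have := h 0 1; rwa [show _root_.natLt 0 1 = true by simp] at this
  | false =>
    have := h 0 0
    rwa [show _root_.natLt 0 0 = false by rw [← Bool.not_eq_true]; simp] at this

section Bool

variable {s t : a.Data → Bool}

theorem not (ht : Computes (a := a) (b := .bool) t) :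
    Computes (a := a) (b := .bool) fun x => !t x := by
  have h := cond (b := .bool) ht (const_bool false) (const_bool true)
  have e : (fun x => !t x) = fun x => bif t x then false else true := by
    funext x; cases t x <;> rfl
  rw [e]; exact h

theorem and (hs : Computes (a := a) (b := .bool) s) (ht : Computes (a := a) (b := .bool) t) :
    Computes (a := a) (b := .bool) fun x => s x && t x := by
  have h := cond (b := .bool) hs ht (const_bool false)
  have e : (fun x => s x && t x) = fun x => bif s x then t x else false := by
    funext x; cases s x <;> rfl
  rw [e]; exact h

theorem or (hs : Computes (a := a) (b := .bool) s) (ht : Computes (a := a) (b := .bool) t) :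
    Computes (a := a) (b := .bool) fun x => s x || t x := by
  have h := cond (b := .bool) hs (const_bool true) ht
  have e : (fun x => s x || t x) = fun x => bif s x then true else t x := by
    funext x; cases s x <;> rfl
  rw [e]; exact h

end Bool

theorem realLe {f g : a.Data → ℝ} (hf : Computes (a := a) (b := .real) f)
    (hg : Computes (a := a) (b := .real) g) :
    Computes (a := a) (b := .bool) fun x => realLe (f x) (g x) :=
  not (realLt hg hf)

theorem natEq {f g : a.Data → ℕ} (hf : Computes (a := a) (b := .nat) f)
    (hg : Computes (a := a) (b := .nat) g) :
    Computes (a := a) (b := .bool) fun x => natEq (f x) (g x) :=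
  and (not (natLt hf hg)) (not (natLt hg hf))

theorem nil : Computes (a := a) (b := .list b) fun _ => ([] : List b.Data) :=
  ⟨.nil, fun x => by simp [Prog.eval]⟩

theorem cons {f : a.Data → b.Data} {l : a.Data → List b.Data} (hf : Computes f)
    (hl : Computes (a := a) (b := .list b) l) :
    Computes (a := a) (b := .list b) fun x => f x :: l x :=
  comp (b := .prod b (.list b)) (c := .list b) (g := fun p : b.Data × List b.Data => p.1 :: p.2)
    ⟨.cons, fun x => by simp [Prog.eval]⟩ (pair hf hl)

/-- With total base and step, induction on the counter shows that the partial recursion is defined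
at every stage. -/
theorem natRec {n : a.Data → ℕ} {z : a.Data → b.Data} {s : a.Data × ℕ × b.Data → b.Data}
    (hn : Computes (a := a) (b := .nat) n) (hz : Computes z)
    (hs : Computes (a := .prod a (.prod .nat b)) (b := b) s) :
    Computes (a := a) (b := b) fun x => Nat.rec (z x) (fun i r => s (x, i, r)) (n x) := by
  obtain ⟨P, hP⟩ := hz
  obtain ⟨Q, hQ⟩ := hs
  refine comp (b := .prod a .nat) (c := b)
    (g := fun p : a.Data × ℕ => Nat.rec (z p.1) (fun i r => s (p.1, i, r)) p.2)
    ⟨.natRec P Q, ?_⟩ (pair id hn)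
  rintro ⟨x, m⟩
  simp only [Prog.eval, hP, hQ]
  induction m with
  | zero => rfl
  | succ m ih => simp only [ih, Part.bind_some]

theorem listRec {l : a.Data → List c.Data} {z : a.Data → b.Data}
    {s : a.Data × c.Data × List c.Data × b.Data → b.Data}
    (hl : Computes (a := a) (b := .list c) l) (hz : Computes z)
    (hs : Computes (a := .prod a (.prod c (.prod (.list c) b))) (b := b) s) :
    Computes (a := a) (b := b)
      fun x => List.rec (z x) (fun h t r => s (x, h, t, r)) (l x) := by
  obtain ⟨P, hP⟩ := hz
  obtain ⟨Q, hQ⟩ := hs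
  refine comp (b := .prod a (.list c)) (c := b)
    (g := fun p : a.Data × List c.Data =>
      List.rec (z p.1) (fun h t r => s (p.1, h, t, r)) p.2)
    ⟨.listRec P Q, ?_⟩ (pair id hl)
  rintro ⟨x, m⟩
  simp only [Prog.eval, hP, hQ]
  induction m with
  | nil => rfl
  | cons h t ih => simp only [ih, Part.bind_some]

theorem foldr {l : a.Data → List c.Data} {z : a.Data → b.Data}
    {s : a.Data → c.Data → b.Data → b.Data}
    (hl : Computes (a := a) (b := .list c) l) (hz : Computes z)
    (hs : Computes (a := .prod a (.prod c b)) (b := b) fun p => s p.1 p.2.1 p.2.2) :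
    Computes (a := a) (b := b) fun x => (l x).foldr (s x) (z x) := by
  have h := listRec (s := fun p => s p.1 p.2.1 p.2.2.2) hl hz
    (comp (a := .prod a (.prod c (.prod (.list c) b))) (b := .prod a (.prod c b))
      (f := fun p => (p.1, p.2.1, p.2.2.2)) hs
      (pair (fst id) (pair (fst (snd id)) (snd (snd (snd id))))))
  have e : (fun x => (l x).foldr (s x) (z x)) = fun x =>
      List.rec (z x) (fun h _ r => s x h r) (l x) := by
    funext x
    induction l x with
    | nil => rfl
    | cons h t ih => simp only [List.foldr_cons, ih]
  rw [e]; exact h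

theorem map {l : a.Data → List b.Data} {f : a.Data → b.Data → c.Data}
    (hl : Computes (a := a) (b := .list b) l)
    (hf : Computes (a := .prod a b) (b := c) fun p => f p.1 p.2) :
    Computes (a := a) (b := .list c) fun x => (l x).map (f x) := by
  have h := foldr (b := .list c) (s := fun x y r => f x y :: r) hl nil
    (cons (comp (a := .prod a (.prod b (.list c))) (b := .prod a b) (f := fun p => (p.1, p.2.1))
      hf (pair (fst id) (fst (snd id)))) (snd (snd id)))
  have e : (fun x => (l x).map (f x)) = fun x => (l x).foldr (fun y r => f x y :: r) [] := by
    funext x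
    induction l x with
    | nil => rfl
    | cons h t ih => simp only [List.foldr_cons, List.map_cons, ih]
  rw [e]; exact h

theorem append {l m : a.Data → List b.Data} (hl : Computes (a := a) (b := .list b) l)
    (hm : Computes (a := a) (b := .list b) m) :
    Computes (a := a) (b := .list b) fun x => l x ++ m x := by
  have h := foldr (b := .list b) (s := fun _ y r => y :: r) hl hm
    (cons (fst (snd id)) (snd (snd id)))
  have e : (fun x => l x ++ m x) = fun x => (l x).foldr (fun y r => y :: r) (m x) := by
    funext x
    simp
  rw [e]; exact h

theorem flatMap {l : a.Data → List b.Data} {f : a.Data → b.Data → List c.Data}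
    (hl : Computes (a := a) (b := .list b) l)
    (hf : Computes (a := .prod a b) (b := .list c) fun p => f p.1 p.2) :
    Computes (a := a) (b := .list c) fun x => (l x).flatMap (f x) := by
  have h := foldr (b := .list c) (s := fun x y r => f x y ++ r) hl nil
    (append (comp (a := .prod a (.prod b (.list c))) (b := .prod a b) (f := fun p => (p.1, p.2.1))
      hf (pair (fst id) (fst (snd id)))) (snd (snd id)))
  have e : (fun x => (l x).flatMap (f x)) = fun x => (l x).foldr (fun y r => f x y ++ r) [] := by
    funext x
    induction l x with
    | nil => rfl
    | cons h t ih => simp only [List.foldr_cons, List.flatMap_cons, ih]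
  rw [e]; exact h

theorem filter {l : a.Data → List b.Data} {f : a.Data → b.Data → Bool}
    (hl : Computes (a := a) (b := .list b) l)
    (hf : Computes (a := .prod a b) (b := .bool) fun p => f p.1 p.2) :
    Computes (a := a) (b := .list b) fun x => (l x).filter (f x) := by
  have h := foldr (b := .list b) (s := fun x y r => bif f x y then y :: r else r) hl nil
    (cond (comp (a := .prod a (.prod b (.list b))) (b := .prod a b) (f := fun p => (p.1, p.2.1))
      hf (pair (fst id) (fst (snd id)))) (cons (fst (snd id)) (snd (snd id))) (snd (snd id)))
  have e : (fun x => (l x).filter (f x)) = fun x =>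
      (l x).foldr (fun y r => bif f x y then y :: r else r) [] := by
    funext x
    induction l x with
    | nil => rfl
    | cons h t ih =>
      rw [List.foldr_cons, ← ih, List.filter_cons]
      cases f x h <;> rfl
  rw [e]; exact h

theorem all {l : a.Data → List b.Data} {f : a.Data → b.Data → Bool}
    (hl : Computes (a := a) (b := .list b) l)
    (hf : Computes (a := .prod a b) (b := .bool) fun p => f p.1 p.2) :
    Computes (a := a) (b := .bool) fun x => (l x).all (f x) := by
  have h := foldr (b := .bool) (s := fun x y r => f x y && r) hl (const_bool true)
    (and (comp (a := .prod a (.prod b .bool)) (b := .prod a b) (f := fun p => (p.1, p.2.1))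
      hf (pair (fst id) (fst (snd id)))) (snd (snd id)))
  have e : (fun x => (l x).all (f x)) = fun x => (l x).foldr (fun y r => f x y && r) true := by
    funext x
    induction l x with
    | nil => rfl
    | cons h t ih => simp only [List.foldr_cons, List.all_cons, ih]
  rw [e]; exact h

theorem any {l : a.Data → List b.Data} {f : a.Data → b.Data → Bool}
    (hl : Computes (a := a) (b := .list b) l)
    (hf : Computes (a := .prod a b) (b := .bool) fun p => f p.1 p.2) :
    Computes (a := a) (b := .bool) fun x => (l x).any (f x) := by
  have h := foldr (b := .bool) (s := fun x y r => f x y || r) hl (const_bool false)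
    (or (comp (a := .prod a (.prod b .bool)) (b := .prod a b) (f := fun p => (p.1, p.2.1))
      hf (pair (fst id) (fst (snd id)))) (snd (snd id)))
  have e : (fun x => (l x).any (f x)) = fun x => (l x).foldr (fun y r => f x y || r) false := by
    funext x
    induction l x with
    | nil => rfl
    | cons h t ih => simp only [List.foldr_cons, List.any_cons, ih]
  rw [e]; exact h

theorem length {l : a.Data → List b.Data} (hl : Computes (a := a) (b := .list b) l) :
    Computes (a := a) (b := .nat) fun x => (l x).length := by
  have h := foldr (b := .nat) (s := fun _ _ r => r + 1) hl zero (succ (snd (snd id)))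
  have e : (fun x => (l x).length) = fun x => (l x).foldr (fun _ r => r + 1) 0 := by
    funext x
    induction l x with
    | nil => rfl
    | cons h t ih => simp only [List.foldr_cons, List.length_cons, ih]
  rw [e]; exact h

theorem flatten {l : a.Data → List (List b.Data)} (hl : Computes (a := a) (b := .list (.list b)) l) :
    Computes (a := a) (b := .list b) fun x => (l x).flatten := by
  have h := flatMap (f := fun _ y => y) hl (snd id)
  simpa [List.flatMap] using h

theorem range {n : a.Data → ℕ} (hn : Computes (a := a) (b := .nat) n) :
    Computes (a := a) (b := .list .nat) fun x => List.range (n x) := by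
  have h := natRec (b := .list .nat) (s := fun p => p.2.2 ++ [p.2.1]) hn nil
    (append (snd (snd id)) (cons (fst (snd id)) nil))
  have e : (fun x => List.range (n x)) = fun x =>
      Nat.rec [] (fun i r => r ++ [i]) (n x) := by
    funext x
    induction n x with
    | zero => rfl
    | succ m ih => simp only [List.range_succ, ih]
  rw [e]; exact h

theorem headD {l : a.Data → List b.Data} {z : a.Data → b.Data}
    (hl : Computes (a := a) (b := .list b) l) (hz : Computes z) :
    Computes (a := a) (b := b) fun x => (l x).headD (z x) := by
  have h := foldr (s := fun _ y _ => y) hl hz (fst (snd id))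
  have e : (fun x => (l x).headD (z x)) = fun x => (l x).foldr (fun y _ => y) (z x) := by
    funext x
    cases l x <;> rfl
  rw [e]; exact h

theorem tail {l : a.Data → List b.Data} (hl : Computes (a := a) (b := .list b) l) :
    Computes (a := a) (b := .list b) fun x => (l x).tail := by
  have h := listRec (b := .list b) (s := fun p => p.2.2.1) hl nil (fst (snd (snd id)))
  have e : (fun x => (l x).tail) = fun x => List.rec [] (fun _ t _ => t) (l x) := by
    funext x
    cases l x <;> rfl
  rw [e]; exact h

theorem getD {l : a.Data → List b.Data} {n : a.Data → ℕ} {z : a.Data → b.Data}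
    (hl : Computes (a := a) (b := .list b) l) (hn : Computes (a := a) (b := .nat) n)
    (hz : Computes z) : Computes (a := a) (b := b) fun x => (l x).getD (n x) (z x) := by
  have h := headD (natRec (b := .list b) (s := fun p => p.2.2.tail) hn hl
    (tail (snd (snd id)))) hz
  have e : (fun x => (l x).getD (n x) (z x)) = fun x =>
      (Nat.rec (l x) (fun _ r => r.tail) (n x) : List b.Data).headD (z x) := by
    funext x
    have : (Nat.rec (l x) (fun _ r => r.tail) (n x) : List b.Data) = (l x).drop (n x) := by
      induction n x with
      | zero => rfl
      | succ m ih => simp only [ih, List.tail_drop]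
    rw [this]
    simp [List.headD_eq_head?_getD, List.head?_drop]
  rw [e]; exact h

end Computes

/-! ### A criterion for trees. -/

/-- A finite graph in which all vertices but one have a unique parent of larger rank is a tree. -/
theorem SimpleGraph.isTree_of_parent {V : Type*} [Finite V] {G : SimpleGraph V} (root : V)
    (P : V → V → Prop) (rank : V → ℕ) (hroot : ∀ w, ¬ P root w)
    (hrank : ∀ v, rank v ≤ rank root) (hex : ∀ v, v ≠ root → ∃ w, rank v < rank w ∧ P v w)
    (huniq : ∀ v w w', P v w → P v w' → w = w') (hadj : ∀ v w, G.Adj v w ↔ P v w ∨ P w v) :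
    G.IsTree := by
  classical
  have := Fintype.ofFinite V
  have hreach : ∀ m v, rank root - rank v ≤ m → G.Reachable v root := by
    intro m
    induction m with
    | zero =>
      intro v hv
      by_cases h : v = root
      · rw [h]
      · obtain ⟨w, hw, -⟩ := hex v h
        have := hrank w
        omega
    | succ m ih =>
      intro v hv
      by_cases h : v = root
      · rw [h]
      · obtain ⟨w, hw, hp⟩ := hex v h
        have := hrank w
        exact ((hadj v w).2 (Or.inl hp)).reachable.trans (ih w (by omega))
  have hconn : G.Connected :=
    { preconnected := fun v w => (hreach _ v le_rfl).trans (hreach _ w le_rfl).symm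
      nonempty := ⟨root⟩ }
  refine SimpleGraph.isTree_iff_connected_and_card.2 ⟨hconn, ?_⟩
  refine le_antisymm ?_ hconn.card_vert_le_card_edgeSet_add_one
  -- Assigning to each vertex other than the root its parent edge exhausts the edges, so there are
  -- at most `|V| - 1`. The value at the root is a dummy.
  let edge : V → Sym2 V := fun v => if h : v = root then s(v, v) else s(v, (hex v h).choose)
  have hsub : G.edgeSet ⊆ ((Finset.univ.erase root).image edge : Finset (Sym2 V)) := by
    intro s
    induction s using Sym2.ind with
    | _ a b =>
      intro hs
      have key : ∀ a b, P a b → s(a, b) ∈ (Finset.univ.erase root).image edge := by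
        intro a b h
        have ha : a ≠ root := fun e => hroot b (e ▸ h)
        refine Finset.mem_image.2 ⟨a, by simp [ha], ?_⟩
        simp only [edge, dif_neg ha]
        rw [huniq a _ _ (hex a ha).choose_spec.2 h]
      rcases (hadj a b).1 hs with h | h
      · exact key a b h
      · rw [Sym2.eq_swap]
        exact key b a h
  have h1 := Nat.card_mono (Finset.finite_toSet _) hsub
  have h2 : ((Finset.univ.erase root).image edge).card ≤ Fintype.card V - 1 := by
    refine Finset.card_image_le.trans ?_
    rw [Finset.card_erase_of_mem (Finset.mem_univ _), Finset.card_univ]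
  have h3 : 0 < Fintype.card V := Fintype.card_pos_iff.2 ⟨root⟩
  simp only [Nat.card_coe_set_eq, Set.ncard_coe_finset] at h1
  rw [Nat.card_coe_set_eq, Nat.card_eq_fintype_card]
  omega

/-! ### Matrices and sorted lists. -/

/-- The entry of a matrix given as a list of rows. -/
def matrixEntry (M : List (List ℝ)) (i j : ℕ) : ℝ := (M.getD i []).getD j 0

/-- Insertion of a number into a strictly increasing list. -/
noncomputable def insertIncreasing (x : ℝ) : List ℝ → List ℝ
  | [] => [x]
  | h :: t => bif realLt x h then x :: h :: t else bif realLt h x then h :: insertIncreasing x t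
      else h :: t

/-- The strictly increasing list of the members of a list. -/
noncomputable def sortedValues (l : List ℝ) : List ℝ := l.foldr insertIncreasing []

theorem mem_insertIncreasing {x y : ℝ} {l : List ℝ} :
    y ∈ insertIncreasing x l ↔ y = x ∨ y ∈ l := by
  induction l with
  | nil => simp [insertIncreasing]
  | cons h t ih =>
    rw [insertIncreasing]
    rcases lt_trichotomy x h with hx | hx | hx
    · simp [realLt_eq_true.2 hx]
    · subst hx
      have : realLt x x = false := by rw [← Bool.not_eq_true]; simp
      simp [this]
    · have : realLt x h = false := by rw [← Bool.not_eq_true]; simpa using hx.le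
      simp only [this, realLt_eq_true.2 hx, cond_false, cond_true, List.mem_cons, ih]
      tauto

theorem pairwise_insertIncreasing {x : ℝ} {l : List ℝ} (hl : l.Pairwise (· < ·)) :
    (insertIncreasing x l).Pairwise (· < ·) := by
  induction l with
  | nil => simp [insertIncreasing]
  | cons h t ih =>
    rw [insertIncreasing]
    have hl' := hl
    rw [List.pairwise_cons] at hl
    rcases lt_trichotomy x h with hx | hx | hx
    · simp only [realLt_eq_true.2 hx, cond_true]
      refine List.pairwise_cons.2 ⟨fun y hy => ?_, hl'⟩
      rcases List.mem_cons.1 hy with rfl | hy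
      · exact hx
      · exact hx.trans (hl.1 y hy)
    · subst hx
      have : realLt x x = false := by rw [← Bool.not_eq_true]; simp
      simpa only [this, cond_false] using hl'
    · have : realLt x h = false := by rw [← Bool.not_eq_true]; simpa using hx.le
      simp only [this, realLt_eq_true.2 hx, cond_false, cond_true]
      refine List.pairwise_cons.2 ⟨fun y hy => ?_, ih hl.2⟩
      rcases mem_insertIncreasing.1 hy with rfl | hy
      · exact hx
      · exact hl.1 y hy

theorem mem_sortedValues {y : ℝ} {l : List ℝ} : y ∈ sortedValues l ↔ y ∈ l := by
  induction l with
  | nil => simp [sortedValues]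
  | cons h t ih =>
    have : sortedValues (h :: t) = insertIncreasing h (sortedValues t) := rfl
    rw [this, mem_insertIncreasing, ih, List.mem_cons]

theorem pairwise_sortedValues (l : List ℝ) : (sortedValues l).Pairwise (· < ·) := by
  induction l with
  | nil => simp [sortedValues]
  | cons h t ih => exact pairwise_insertIncreasing ih

/-! ### The tree of an ultrametric

The vertex `(i, x)` is the cluster of the point `x` at the `i`-th value of the ultrametric. -/

/-- The first point in the cluster of `x` at level `i`; all points share one cluster above the
last level. -/
noncomputable def clusterRep (n : ℕ) (M : List (List ℝ)) (τ : List ℝ) (i x : ℕ) : ℕ :=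
  ((List.range n).filter fun y =>
    realLe (matrixEntry M x y) (τ.getD i 0) || !natLt i τ.length).headD 0

noncomputable def clusterParent (n : ℕ) (M : List (List ℝ)) (τ : List ℝ) (v : ℕ × ℕ) : ℕ × ℕ :=
  (v.1 + 1, clusterRep n M τ (v.1 + 1) v.2)

/-- Every pair is kept, also when the point does not represent its cluster: for an ultrametric such
pairs are leaves off the paths between points. The apex `(τ.length, 0)` makes the graph a tree for
every `M` and `τ`, including empty ones. -/
def clusterVertices (n : ℕ) (τ : List ℝ) : List (ℕ × ℕ) :=
  ((List.range τ.length).flatMap fun i => (List.range n).map fun x => (i, x)) ++ [(τ.length, 0)]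

/-- The gap is halved because a path climbs it once and descends it once. The weight `1` occurs in
place of a nonpositive gap, as at the apex, where the default `0` is read beyond the list; it keeps
all weights positive. -/
noncomputable def levelWeight (τ : List ℝ) (i : ℕ) : ℝ :=
  bif realLt (τ.getD i 0) (τ.getD (i + 1) 0) then (τ.getD (i + 1) 0 - τ.getD i 0) / (2 : ℕ)
    else (1 : ℕ)

noncomputable def isClusterParent (n : ℕ) (M : List (List ℝ)) (τ : List ℝ) (v w : ℕ × ℕ) : Bool :=
  natEq (clusterParent n M τ v).1 w.1 && natEq (clusterParent n M τ v).2 w.2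

/-- The weighted adjacency matrix of the tree of an ultrametric with values `τ`. -/
noncomputable def clusterTreeMatrix (n : ℕ) (M : List (List ℝ)) (τ : List ℝ) : List (List ℝ) :=
  (clusterVertices n τ).map fun v => (clusterVertices n τ).map fun w =>
    bif isClusterParent n M τ v w then levelWeight τ v.1
      else bif isClusterParent n M τ w v then levelWeight τ w.1 else (0 : ℕ)

section ClusterTree

variable {n : ℕ} {M : List (List ℝ)} {τ : List ℝ}

theorem isClusterParent_eq_true {v w : ℕ × ℕ} :
    isClusterParent n M τ v w = true ↔ clusterParent n M τ v = w := by
  simp [isClusterParent, Prod.ext_iff]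

theorem levelWeight_pos (i : ℕ) : 0 < levelWeight τ i := by
  rw [levelWeight]
  by_cases h : τ.getD i 0 < τ.getD (i + 1) 0
  · rw [realLt_eq_true.2 h, cond_true]
    push_cast
    linarith
  · rw [← realLt_eq_true, Bool.not_eq_true] at h
    rw [h, cond_false]
    norm_num

theorem mem_clusterVertices {v : ℕ × ℕ} :
    v ∈ clusterVertices n τ ↔ (v.1 < τ.length ∧ v.2 < n) ∨ v = (τ.length, 0) := by
  obtain ⟨i, x⟩ := v
  simp [clusterVertices]

theorem nodup_clusterVertices : (clusterVertices n τ).Nodup := by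
  rw [clusterVertices, List.nodup_append]
  refine ⟨?_, by simp, ?_⟩
  · exact List.nodup_range.product List.nodup_range
  · rintro ⟨i, x⟩ h ⟨j, y⟩ h' e
    simp at h h'
    simp at e
    omega

theorem clusterRep_lt {x : ℕ} (i : ℕ) (hx : x < n) : clusterRep n M τ i x < n := by
  rw [clusterRep]
  set l := (List.range n).filter fun y =>
    realLe (matrixEntry M x y) (τ.getD i 0) || !natLt i τ.length with hl
  rcases e : l with _ | ⟨y, t⟩
  · simp; omega
  · have : y ∈ l := by simp [e]
    rw [hl, List.mem_filter, List.mem_range] at this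
    simpa using this.1

theorem clusterRep_top (x : ℕ) : clusterRep n M τ τ.length x = 0 := by
  have h : natLt τ.length τ.length = false := by rw [← Bool.not_eq_true]; simp
  simp only [clusterRep, h, Bool.not_false, Bool.or_true, List.filter_true]
  cases n <;> simp [List.range_succ_eq_map]

theorem clusterParent_mem {v : ℕ × ℕ} (h1 : v.1 < τ.length) (h2 : v.2 < n) :
    clusterParent n M τ v ∈ clusterVertices n τ := by
  rw [mem_clusterVertices, clusterParent]
  rcases Nat.lt_or_ge (v.1 + 1) τ.length with h | h
  · exact Or.inl ⟨h, clusterRep_lt _ h2⟩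
  · have : v.1 + 1 = τ.length := by omega
    right
    rw [this, clusterRep_top]

variable (n M τ) in
/-- The graph of the cluster tree. -/
def clusterGraph : SimpleGraph {v // v ∈ clusterVertices n τ} where
  Adj v w := clusterParent n M τ v = w ∨ clusterParent n M τ w = v
  symm := ⟨fun _ _ h => Or.symm h⟩
  loopless := ⟨fun v h => by
    have : clusterParent n M τ v = v := by simpa using h
    have := congrArg Prod.fst this
    simp [clusterParent] at this⟩

variable (n τ) in
/-- The edge weights of the cluster tree. -/
noncomputable def clusterWeight : Sym2 {v // v ∈ clusterVertices n τ} → ℝ :=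
  Sym2.lift ⟨fun v w => levelWeight τ (min v.1.1 w.1.1), fun v w => by simp only [min_comm]⟩

theorem clusterWeight_mk (v w : {v // v ∈ clusterVertices n τ}) :
    clusterWeight n τ s(v, w) = levelWeight τ (min v.1.1 w.1.1) := rfl

theorem clusterGraph_isTree : (clusterGraph n M τ).IsTree := by
  have hmem : ∀ v : {v // v ∈ clusterVertices n τ}, v.1.1 ≤ τ.length := fun v => by
    rcases mem_clusterVertices.1 v.2 with h | h
    · exact h.1.le
    · rw [h]
  have : Finite {v // v ∈ clusterVertices n τ} := (clusterVertices n τ).finite_toSet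
  refine SimpleGraph.isTree_of_parent ⟨(τ.length, 0), mem_clusterVertices.2 (Or.inr rfl)⟩
    (fun v w => clusterParent n M τ v = w) (fun v => v.1.1) ?_ hmem ?_ ?_ fun v w => Iff.rfl
  · intro w h
    have := congrArg Prod.fst h
    have h' := hmem w
    simp [clusterParent] at this
    omega
  · intro v hv
    rcases mem_clusterVertices.1 v.2 with h | h
    · exact ⟨⟨_, clusterParent_mem h.1 h.2⟩, by simp [clusterParent], rfl⟩
    · exact absurd (Subtype.ext h) hv
  · intro v w w' h h'
    exact Subtype.ext (h.symm.trans h')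

/-- The cluster tree of a matrix of order `n`, on the points numbered by `e`. -/
noncomputable def clusterTree {X : Type*} (e : Fin n ≃ X) (M : List (List ℝ)) (τ : List ℝ)
    (hτ : 0 < n → 0 < τ.length) : WeightedTree X where
  V := {v // v ∈ clusterVertices n τ}
  graph := clusterGraph n M τ
  isTree := clusterGraph_isTree
  weight := clusterWeight n τ
  weight_pos s _ := by
    induction s using Sym2.ind with
    | _ v w => exact levelWeight_pos _
  point :=
    { toFun := fun x => ⟨(0, e.symm x), mem_clusterVertices.2
        (Or.inl ⟨hτ (Nat.zero_lt_of_lt (e.symm x).2), (e.symm x).2⟩)⟩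
      inj' := fun x y h => by
        have := congrArg (fun v => v.1.2) h
        exact e.symm.injective (Fin.ext this) }

/-- Level `0` is listed first, which gives the points of `X` the numbers that `IsAdjacencyMatrix`
demands. -/
theorem clusterVertices_getElem {i : ℕ} (hi : i < n) (hτ : 0 < τ.length)
    (h : i < (clusterVertices n τ).length) : (clusterVertices n τ)[i] = (0, i) := by
  obtain ⟨m, hm⟩ : ∃ m, τ.length = m + 1 := ⟨τ.length - 1, by omega⟩
  simp only [clusterVertices, hm, List.range_succ_eq_map, List.flatMap_cons, List.append_assoc]
  rw [List.getElem_append_left (by simpa using hi)]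
  simp

open Classical in
theorem clusterTree_adjEntry {X : Type*} (e : Fin n ≃ X) (hτ : 0 < n → 0 < τ.length)
    (v w : {v // v ∈ clusterVertices n τ}) :
    (bif isClusterParent n M τ v w then levelWeight τ v.1.1
      else bif isClusterParent n M τ w v then levelWeight τ w.1.1 else (0 : ℕ)) =
      (clusterTree e M τ hτ).adjEntry v w := by
  change _ = if (clusterGraph n M τ).Adj v w then clusterWeight n τ s(v, w) else 0
  rw [clusterWeight_mk]
  by_cases hvw : clusterParent n M τ v = w
  · rw [if_pos (show (clusterGraph n M τ).Adj v w from Or.inl hvw), isClusterParent_eq_true.2 hvw, cond_true]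
    have := congrArg Prod.fst hvw
    simp only [clusterParent] at this
    rw [min_eq_left (by omega)]
  · have hvw' : isClusterParent n M τ v w = false := by
      rwa [← Bool.not_eq_true, isClusterParent_eq_true]
    rw [hvw', cond_false]
    by_cases hwv : clusterParent n M τ w = v
    · rw [if_pos (show (clusterGraph n M τ).Adj v w from Or.inr hwv),
        isClusterParent_eq_true.2 hwv, cond_true]
      have := congrArg Prod.fst hwv
      simp only [clusterParent] at this
      rw [min_eq_right (by omega)]
    · have hwv' : isClusterParent n M τ w v = false := by
        rwa [← Bool.not_eq_true, isClusterParent_eq_true]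
      rw [hwv', cond_false, if_neg (fun h : (clusterGraph n M τ).Adj v w => h.elim hvw hwv)]
      simp

theorem clusterTree_isAdjacencyMatrix {X : Type*} (e : Fin n ≃ X) (hτ : 0 < n → 0 < τ.length) :
    (clusterTree e M τ hτ).IsAdjacencyMatrix e (clusterTreeMatrix n M τ) := by
  classical
  have hlen : (clusterVertices n τ).length = (clusterTreeMatrix n M τ).length := by
    simp [clusterTreeMatrix]
  let φ : {v // v ∈ clusterVertices n τ} ≃ Fin (clusterTreeMatrix n M τ).length :=
    (nodup_clusterVertices.getEquiv (clusterVertices n τ)).symm.trans (finCongr hlen)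
  have hφ : ∀ a, (φ.symm a).1 = (clusterVertices n τ)[(a : ℕ)]'(a.2.trans_eq hlen.symm) := fun a => rfl
  refine ⟨φ, fun i => ?_, ?_⟩
  · have h0 : (i : ℕ) < n := i.2
    have hi : (i : ℕ) < (clusterTreeMatrix n M τ).length := by
      have := List.idxOf_lt_length_of_mem ((clusterTree e M τ hτ).point (e i)).2
      rw [← hlen]
      have h2 : (clusterVertices n τ).length = τ.length * n + 1 := by
        simp [clusterVertices, List.length_flatMap, List.map_const']
      rw [h2]
      nlinarith [hτ (by omega)]
    have : (clusterTree e M τ hτ).point (e i) = φ.symm ⟨i, hi⟩ := by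
      apply Subtype.ext
      rw [hφ, clusterVertices_getElem h0 (hτ (by omega))]
      exact Prod.ext rfl (congrArg Fin.val (e.symm_apply_apply i))
    exact congrArg Fin.val ((congrArg φ this).trans (φ.apply_symm_apply _))
  · apply List.ext_getElem
    · simp
    intro a ha ha'
    apply List.ext_getElem
    · simp [clusterTreeMatrix]
    intro b hb hb'
    simp only [List.getElem_ofFn]
    have hb2 : b < (clusterTreeMatrix n M τ).length := by simpa using hb'
    have h1 := hφ ⟨a, ha⟩
    have h2 := hφ ⟨b, hb2⟩
    have hent : (clusterTreeMatrix n M τ)[a][b] =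
        bif isClusterParent n M τ (clusterVertices n τ)[a] (clusterVertices n τ)[b] then
          levelWeight τ (clusterVertices n τ)[a].1
        else bif isClusterParent n M τ (clusterVertices n τ)[b] (clusterVertices n τ)[a] then
          levelWeight τ (clusterVertices n τ)[b].1 else (0 : ℕ) := by
      simp [clusterTreeMatrix]
    rw [hent]
    simp only at h1 h2
    rw [← h1, ← h2]
    exact clusterTree_adjEntry e hτ _ _

end ClusterTree

/-! ### Distances in the cluster tree. -/

/-- The matrix `M` of order `n` is an ultrametric on `{0, …, n - 1}`. -/
structure IsUltrametricMatrix (n : ℕ) (M : List (List ℝ)) : Prop where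
  self : ∀ x < n, matrixEntry M x x = 0
  symm : ∀ x < n, ∀ y < n, matrixEntry M x y = matrixEntry M y x
  ultra : ∀ x < n, ∀ y < n, ∀ z < n,
    matrixEntry M x z ≤ max (matrixEntry M x y) (matrixEntry M y z)
  pos : ∀ x < n, ∀ y < n, x ≠ y → 0 < matrixEntry M x y

section ClusterDist

variable {n : ℕ} {M : List (List ℝ)} {τ : List ℝ}

theorem getD_lt_getD (hs : τ.Pairwise (· < ·)) {i j : ℕ} (hij : i < j) (hj : j < τ.length) :
    τ.getD i 0 < τ.getD j 0 := by
  rw [List.getD_eq_getElem _ _ (hij.trans hj), List.getD_eq_getElem _ _ hj]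
  exact List.pairwise_iff_getElem.1 hs i j _ _ hij

theorem clusterRep_spec (hM : IsUltrametricMatrix n M) {i x : ℕ} (hi : i < τ.length)
    (hx : x < n) (h0 : 0 ≤ τ.getD i 0) : matrixEntry M x (clusterRep n M τ i x) ≤ τ.getD i 0 := by
  rw [clusterRep]
  set l := (List.range n).filter fun y =>
    realLe (matrixEntry M x y) (τ.getD i 0) || !natLt i τ.length with hl
  have hxl : x ∈ l := by
    rw [hl, List.mem_filter, List.mem_range]
    refine ⟨hx, ?_⟩
    rw [hM.self x hx, realLe_eq_true.2 h0, Bool.true_or]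
  rcases e : l with _ | ⟨y, t⟩
  · simp [e] at hxl
  · have : y ∈ l := by simp [e]
    rw [hl, List.mem_filter, List.mem_range, natLt_eq_true.2 hi] at this
    simpa using this.2

/-- For an ultrametric, being at distance at most `τ i` is an equivalence relation, so equivalent
points filter out the same list and share its first member. -/
theorem clusterRep_eq_iff (hM : IsUltrametricMatrix n M) {i x y : ℕ} (hi : i < τ.length)
    (hx : x < n) (hy : y < n) (h0 : 0 ≤ τ.getD i 0) :
    clusterRep n M τ i x = clusterRep n M τ i y ↔ matrixEntry M x y ≤ τ.getD i 0 := by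
  constructor
  · intro h
    have h1 := clusterRep_spec hM hi hx h0
    have h2 := clusterRep_spec hM hi hy h0
    have hr := clusterRep_lt (M := M) (τ := τ) i hy
    rw [h] at h1
    rw [hM.symm y hy _ hr] at h2
    exact (hM.ultra x hx _ hr y hy).trans (max_le h1 h2)
  · intro h
    rw [clusterRep, clusterRep]
    congr 1
    apply List.filter_congr
    intro z hz
    rw [List.mem_range] at hz
    congr 1
    rw [Bool.eq_iff_iff, realLe_eq_true, realLe_eq_true]
    constructor
    · intro h'
      have := hM.ultra y hy x hx z hz
      rw [hM.symm y hy x hx] at this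
      exact this.trans (max_le h h')
    · intro h'
      exact (hM.ultra x hx y hy z hz).trans (max_le h h')

/-- The clusters of two points merge exactly at the level `j` whose value is their distance. The
path climbs to that level and descends, and twice the half gaps add up to `τ j - τ 0`. The diagonal
forces `τ 0 = 0`, and the clusters at level `0` are single points. -/
theorem clusterTree_treeDist {X : Type*} (e : Fin n ≃ X) (hτ : 0 < n → 0 < τ.length)
    (hM : IsUltrametricMatrix n M) (hs : τ.Pairwise (· < ·)) (hnn : ∀ t ∈ τ, 0 ≤ t)
    (hmem : ∀ x < n, ∀ y < n, matrixEntry M x y ∈ τ) (x y : X) :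
    (clusterTree e M τ hτ).treeDist x y = matrixEntry M (e.symm x) (e.symm y) := by
  have hx : (e.symm x : ℕ) < n := (e.symm x).2
  have hy : (e.symm y : ℕ) < n := (e.symm y).2
  set p : ℕ := (e.symm x : ℕ) with hp
  set q : ℕ := (e.symm y : ℕ) with hq
  have hnn' : ∀ i < τ.length, 0 ≤ τ.getD i 0 := fun i hi => by
    rw [List.getD_eq_getElem _ _ hi]
    exact hnn _ (List.getElem_mem _)
  have hlen : 0 < τ.length := hτ (by omega)
  have hzero : τ.getD 0 0 = 0 := by
    obtain ⟨i, hi, e⟩ := List.mem_iff_getElem.1 (hmem p hx p hx)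
    rw [hM.self p hx, ← List.getD_eq_getElem _ 0 hi] at e
    rcases Nat.eq_zero_or_pos i with h | h
    · rw [h] at e; exact e
    · have := getD_lt_getD hs h hi
      have := hnn' 0 hlen
      linarith
  obtain ⟨j, hj, hval⟩ := List.mem_iff_getElem.1 (hmem p hx q hy)
  rw [← List.getD_eq_getElem _ 0 hj] at hval
  have hanc : ∀ i < τ.length, ∀ z < n, (i, clusterRep n M τ i z) ∈ clusterVertices n τ :=
    fun i hi z hz => mem_clusterVertices.2 (Or.inl ⟨hi, clusterRep_lt _ hz⟩)
  have hpar : ∀ i, i + 1 < τ.length → ∀ z < n,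
      clusterParent n M τ (i, clusterRep n M τ i z) = (i + 1, clusterRep n M τ (i + 1) z) := by
    intro i hi z hz
    have h1 := clusterRep_spec hM (by omega : i < τ.length) hz (hnn' i (by omega))
    have hr := clusterRep_lt (M := M) (τ := τ) i hz
    rw [clusterParent, Prod.mk.injEq]
    refine ⟨rfl, (clusterRep_eq_iff hM hi hr hz (hnn' _ hi)).2 ?_⟩
    rw [hM.symm _ hr z hz]
    exact h1.trans (getD_lt_getD hs (Nat.lt_succ_self i) hi).le
  have hrep0 : ∀ z < n, clusterRep n M τ 0 z = z := by
    intro z hz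
    by_contra hne
    have h1 := clusterRep_spec hM hlen hz (hnn' 0 hlen)
    have := hM.pos z hz _ (clusterRep_lt (M := M) (τ := τ) 0 hz) (Ne.symm hne)
    linarith
  -- The path grows from the merging level downwards, one edge at each end. That its vertices stay
  -- at level `i` or above shows that the new end vertices are not yet on it.
  have hpath : ∀ d i (hd : i + d = j), ∃ w : (clusterGraph n M τ).Walk
      ⟨(i, clusterRep n M τ i p), hanc i (by omega) p hx⟩
      ⟨(i, clusterRep n M τ i q), hanc i (by omega) q hy⟩,
      w.IsPath ∧ (∀ v ∈ w.support, i ≤ v.1.1) ∧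
        (w.edges.map (clusterWeight n τ)).sum = τ.getD j 0 - τ.getD i 0 := by
    intro d
    induction d with
    | zero =>
      intro i hd
      obtain rfl : i = j := by omega
      have hrep : clusterRep n M τ i p = clusterRep n M τ i q :=
        (clusterRep_eq_iff hM hj hx hy (hnn' i hj)).2 hval.ge
      refine ⟨SimpleGraph.Walk.nil.copy rfl (Subtype.ext (by simp [hrep])), ?_, ?_, ?_⟩
      · simp
      · intro v hv
        simp only [SimpleGraph.Walk.support_copy, SimpleGraph.Walk.support_nil,
          List.mem_singleton] at hv
        rw [hv]
      · simp
    | succ d ih =>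
      intro i hd
      obtain ⟨w, hw, hsupp, hsum⟩ := ih (i + 1) (by omega)
      have hi1 : i + 1 < τ.length := by omega
      have hlt := getD_lt_getD hs (Nat.lt_succ_self i) hi1
      have hne : clusterRep n M τ i p ≠ clusterRep n M τ i q := fun h => by
        have h1 := (clusterRep_eq_iff hM (by omega) hx hy (hnn' i (by omega))).1 h
        have h2 := getD_lt_getD hs (show i < j by omega) hj
        linarith
      have hup : ∀ z (hz : z < n), (clusterGraph n M τ).Adj
          ⟨(i, clusterRep n M τ i z), hanc i (by omega) z hz⟩
          ⟨(i + 1, clusterRep n M τ (i + 1) z), hanc (i + 1) hi1 z hz⟩ :=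
        fun z hz => Or.inl (hpar i hi1 z hz)
      have hweight : levelWeight τ i = (τ.getD (i + 1) 0 - τ.getD i 0) / 2 := by
        rw [levelWeight, realLt_eq_true.2 hlt, cond_true]
        norm_num
      have hnot : ∀ z (hz : z < n), (⟨(i, clusterRep n M τ i z), hanc i (by omega) z hz⟩ :
          {v // v ∈ clusterVertices n τ}) ∉ w.support := fun z hz h => by
        have := hsupp _ h
        simp at this
      refine ⟨SimpleGraph.Walk.cons (hup p hx) (w.concat (hup q hy).symm), ?_, ?_, ?_⟩
      · rw [SimpleGraph.Walk.cons_isPath_iff]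
        refine ⟨hw.concat (hnot q hy) _, ?_⟩
        rw [SimpleGraph.Walk.support_concat]
        simp only [List.mem_append, List.mem_singleton, not_or]
        refine ⟨hnot p hx, fun h => hne ?_⟩
        exact congrArg (fun v => v.1.2) h
      · intro v hv
        rw [SimpleGraph.Walk.support_cons, SimpleGraph.Walk.support_concat] at hv
        simp only [List.mem_cons, List.mem_append, List.not_mem_nil, or_false] at hv
        rcases hv with rfl | hv | rfl
        · exact le_rfl
        · exact (Nat.le_succ i).trans (hsupp v hv)
        · simp
      · rw [SimpleGraph.Walk.edges_cons, SimpleGraph.Walk.edges_concat]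
        simp only [List.concat_eq_append, List.map_cons, List.map_append, List.sum_cons,
          List.sum_append, hsum, List.map_nil, List.sum_nil]
        have h1 : (clusterWeight n τ)
            s(⟨(i, clusterRep n M τ i p), hanc i (by omega) p hx⟩,
              ⟨(i + 1, clusterRep n M τ (i + 1) p), hanc (i + 1) hi1 p hx⟩) = levelWeight τ i := by
          rw [clusterWeight_mk, min_eq_left (by simp)]
        have h2 : (clusterWeight n τ)
            s(⟨(i + 1, clusterRep n M τ (i + 1) q), hanc (i + 1) hi1 q hy⟩,
              ⟨(i, clusterRep n M τ i q), hanc i (by omega) q hy⟩) = levelWeight τ i := by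
          rw [clusterWeight_mk, min_eq_right (by simp)]
        rw [h1, h2, hweight]
        ring
  obtain ⟨w, hw, -, hsum⟩ := hpath j 0 (by omega)
  have hpt : ∀ z : X, (⟨(0, clusterRep n M τ 0 (e.symm z)), hanc 0 hlen _ (e.symm z).2⟩ :
      {v // v ∈ clusterVertices n τ}) = (clusterTree e M τ hτ).point z := fun z =>
    Subtype.ext (Prod.ext rfl (hrep0 _ (e.symm z).2))
  have hw' : ∃ w' : (clusterTree e M τ hτ).graph.Walk ((clusterTree e M τ hτ).point x)
      ((clusterTree e M τ hτ).point y), w'.IsPath ∧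
      (w'.edges.map (clusterTree e M τ hτ).weight).sum = matrixEntry M p q := by
    rw [← hpt x, ← hpt y]
    exact ⟨w, hw, hsum.trans (by rw [hzero, hval, sub_zero])⟩
  obtain ⟨w', hw', hsum'⟩ := hw'
  rw [WeightedTree.treeDist, WeightedTree.vertexDist,
    ← ((clusterTree e M τ hτ).isTree.existsUnique_path _ _).choose_spec.2 w' hw', hsum']

end ClusterDist

/-! ### Exhaustive search. -/

/-- All lists of a given length with members in `l`. -/
def listsOfLength {α : Type*} (l : List α) : ℕ → List (List α)
  | 0 => [[]]
  | m + 1 => l.flatMap fun x => (listsOfLength l m).map fun t => x :: t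

theorem mem_listsOfLength {α : Type*} {l : List α} {m : ℕ} {t : List α} :
    t ∈ listsOfLength l m ↔ t.length = m ∧ ∀ x ∈ t, x ∈ l := by
  induction m generalizing t with
  | zero =>
    simp only [listsOfLength, List.mem_singleton, List.length_eq_zero_iff]
    constructor
    · rintro rfl; simp
    · exact fun h => h.1
  | succ m ih =>
    simp only [listsOfLength, List.mem_flatMap, List.mem_map]
    constructor
    · rintro ⟨x, hx, t, ht, rfl⟩
      obtain ⟨h1, h2⟩ := ih.1 ht
      refine ⟨by simp [h1], fun y hy => ?_⟩
      rcases List.mem_cons.1 hy with rfl | hy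
      · exact hx
      · exact h2 y hy
    · rintro ⟨h1, h2⟩
      cases t with
      | nil => simp at h1
      | cons x t =>
        exact ⟨x, h2 x (by simp), t, ih.2 ⟨by simpa using h1, fun y hy => h2 y (by simp [hy])⟩, rfl⟩

/-- The test whether `M` is an ultrametric that dominates the metric `D`. -/
noncomputable def isDominatingUltrametric (n : ℕ) (D M : List (List ℝ)) : Bool :=
  (List.range n).all fun x => realLe (matrixEntry M x x) (0 : ℕ) &&
    (List.range n).all fun y => (realLe (matrixEntry D x y) (matrixEntry M x y) &&
      realLe (matrixEntry M x y) (matrixEntry M y x)) &&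
      (List.range n).all fun z => realLe (matrixEntry M x z) (matrixEntry M x y) ||
        realLe (matrixEntry M x z) (matrixEntry M y z)

/-- The test whether each point has a member of `F` with distortion at most `16 L`. -/
noncomputable def isRamseyFamily (n L : ℕ) (D : List (List ℝ)) (F : List (List (List ℝ))) : Bool :=
  (List.range n).all fun u => F.any fun M => (List.range n).all fun v =>
    realLe (matrixEntry M u v) (((16 : ℕ) : ℝ) * (L : ℝ) * matrixEntry D u v)

/-- The families of `k` matrices that pass both tests, with entries among the distances. -/
noncomputable def ramseyFamilies (k : ℕ) (D : List (List ℝ)) (L : ℕ) : List (List (List (List ℝ))) :=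
  (listsOfLength (listsOfLength (listsOfLength D.flatten D.length) D.length) k).filter fun F =>
    F.all (isDominatingUltrametric D.length D) && isRamseyFamily D.length L D F

/-- The first family found by an exhaustive search with increasing distortion `16 L`. -/
noncomputable def bestRamseyFamily (k : ℕ) (D : List (List ℝ)) : List (List (List ℝ)) :=
  -- The candidates `0, …, n + 1` contain the `L` of `exists_distortion_bound`, so for a distance
  -- matrix and `k ≥ 1` the search succeeds and the default `[]` does not intervene.
  ((List.range (D.length + 2)).flatMap (ramseyFamilies k D)).headD []

/-- The output of the algorithm. -/
noncomputable def ramseyTreeCover (k : ℕ) (D : List (List ℝ)) : List (List (List ℝ)) :=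
  (bestRamseyFamily k D).map fun M => clusterTreeMatrix D.length M (sortedValues M.flatten)

/-! ### The algorithm is a program -/

namespace Computes

variable {a b c : Ty}

/-- Under a bound variable the environment becomes a pair: `lift` weakens a function of the outer
environment and `var` is the innermost variable. -/
theorem lift {f : a.Data → b.Data} (hf : Computes f) :
    Computes (a := .prod a c) (b := b) fun p => f p.1 := comp hf (fst id)

theorem var : Computes (a := .prod a c) (b := c) fun p => p.2 := snd id

theorem listsOfLength {l : a.Data → List b.Data} {m : a.Data → ℕ}
    (hl : Computes (a := a) (b := .list b) l) (hm : Computes (a := a) (b := .nat) m) :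
    Computes (a := a) (b := .list (.list b)) fun x => listsOfLength (l x) (m x) := by
  have h := natRec (b := .list (.list b))
    (s := fun p => (l p.1).flatMap fun y => p.2.2.map fun t => y :: t) hm (cons nil nil)
    (flatMap (a := .prod a (.prod .nat (.list (.list b)))) (b := b) (c := .list b)
      (f := fun p y => p.2.2.map fun t => y :: t) (lift hl)
      (map (a := .prod (.prod a (.prod .nat (.list (.list b)))) b) (b := .list b) (c := .list b)
        (f := fun p t => p.2 :: t) (snd (snd (fst id)))
        (cons (lift var) var)))
  have e : (fun x => _root_.listsOfLength (l x) (m x)) = fun x =>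
      Nat.rec [[]] (fun _ r => (l x).flatMap fun y => r.map fun t => y :: t) (m x) := by
    funext x
    induction m x with
    | zero => rfl
    | succ m ih => simp only [_root_.listsOfLength, ih]
  rw [e]; exact h

theorem matrixEntry {M : a.Data → List (List ℝ)} {i j : a.Data → ℕ}
    (hM : Computes (a := a) (b := .list (.list .real)) M)
    (hi : Computes (a := a) (b := .nat) i) (hj : Computes (a := a) (b := .nat) j) :
    Computes (a := a) (b := .real) fun x => matrixEntry (M x) (i x) (j x) := by
  have hz := natCast (zero (a := a))
  simp only [Nat.cast_zero] at hz
  exact getD (b := .real) (getD (b := .list .real) hM hi nil) hj hz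

theorem insertIncreasing {y : a.Data → ℝ} {l : a.Data → List ℝ}
    (hy : Computes (a := a) (b := .real) y) (hl : Computes (a := a) (b := .list .real) l) :
    Computes (a := a) (b := .list .real) fun x => insertIncreasing (y x) (l x) := by
  have h := listRec (b := .list .real) (c := .real)
    (s := fun p => bif _root_.realLt (y p.1) p.2.1 then y p.1 :: p.2.1 :: p.2.2.1 else
      bif _root_.realLt p.2.1 (y p.1) then p.2.1 :: p.2.2.2 else p.2.1 :: p.2.2.1)
    hl (cons hy nil)
    (cond (realLt (lift hy) (fst var)) (cons (lift hy) (cons (fst var) (fst (snd var))))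
      (cond (realLt (fst var) (lift hy)) (cons (fst var) (snd (snd var)))
        (cons (fst var) (fst (snd var)))))
  have e : (fun x => _root_.insertIncreasing (y x) (l x)) = fun x =>
      List.rec [y x] (fun h t r => bif _root_.realLt (y x) h then y x :: h :: t else
        bif _root_.realLt h (y x) then h :: r else h :: t) (l x) := by
    funext x
    induction l x with
    | nil => rfl
    | cons h t ih => simp only [_root_.insertIncreasing, ih]
  rw [e]; exact h

theorem sortedValues {l : a.Data → List ℝ} (hl : Computes (a := a) (b := .list .real) l) :
    Computes (a := a) (b := .list .real) fun x => sortedValues (l x) :=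
  foldr (b := .list .real) (c := .real) (s := fun _ y r => _root_.insertIncreasing y r) hl nil
    (insertIncreasing (fst var) (snd var))

section ClusterTree

variable {n i y : a.Data → ℕ} {M : a.Data → List (List ℝ)} {τ : a.Data → List ℝ}
  {v w : a.Data → ℕ × ℕ}

theorem clusterRep (hn : Computes (a := a) (b := .nat) n)
    (hM : Computes (a := a) (b := .list (.list .real)) M)
    (hτ : Computes (a := a) (b := .list .real) τ) (hi : Computes (a := a) (b := .nat) i)
    (hy : Computes (a := a) (b := .nat) y) :
    Computes (a := a) (b := .nat) fun x => clusterRep (n x) (M x) (τ x) (i x) (y x) := by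
  have hz := natCast (zero (a := .prod a .nat))
  simp only [Nat.cast_zero] at hz
  exact headD (b := .nat) (filter (b := .nat)
    (f := fun x z => _root_.realLe (_root_.matrixEntry (M x) (y x) z) ((τ x).getD (i x) 0) ||
      !_root_.natLt (i x) (τ x).length) (range hn)
    (or (realLe (matrixEntry (lift hM) (lift hy) var) (getD (b := .real) (lift hτ) (lift hi) hz))
      (not (natLt (lift hi) (length (b := .real) (lift hτ)))))) zero

theorem clusterVertices (hn : Computes (a := a) (b := .nat) n)
    (hτ : Computes (a := a) (b := .list .real) τ) :
    Computes (a := a) (b := .list (.prod .nat .nat)) fun x => clusterVertices (n x) (τ x) :=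
  append (b := .prod .nat .nat) (flatMap (b := .nat) (c := .prod .nat .nat)
    (f := fun x i => (List.range (n x)).map fun y => (i, y)) (range (length (b := .real) hτ))
    (map (a := .prod a .nat) (b := .nat) (c := .prod .nat .nat) (f := fun p y => (p.2, y)) (range (lift hn))
      (pair (lift var) var)))
    (cons (b := .prod .nat .nat) (pair (length (b := .real) hτ) zero) nil)

theorem levelWeight (hτ : Computes (a := a) (b := .list .real) τ)
    (hi : Computes (a := a) (b := .nat) i) :
    Computes (a := a) (b := .real) fun x => levelWeight (τ x) (i x) := by
  have hz := natCast (zero (a := a))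
  simp only [Nat.cast_zero] at hz
  have h0 := getD (b := .real) hτ hi hz
  have h1 := getD (b := .real) hτ (succ hi) hz
  exact cond (b := .real) (realLt h0 h1) (div (sub h1 h0) (natCast (const_nat 2)))
    (natCast (const_nat 1))

theorem isClusterParent (hn : Computes (a := a) (b := .nat) n)
    (hM : Computes (a := a) (b := .list (.list .real)) M)
    (hτ : Computes (a := a) (b := .list .real) τ)
    (hv : Computes (a := a) (b := .prod .nat .nat) v)
    (hw : Computes (a := a) (b := .prod .nat .nat) w) :
    Computes (a := a) (b := .bool) fun x => isClusterParent (n x) (M x) (τ x) (v x) (w x) :=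
  and (natEq (succ (fst (b := .nat) hv)) (fst (b := .nat) hw))
    (natEq (clusterRep hn hM hτ (succ (fst (b := .nat) hv)) (snd (c := .nat) hv))
      (snd (c := .nat) hw))

theorem clusterTreeMatrix (hn : Computes (a := a) (b := .nat) n)
    (hM : Computes (a := a) (b := .list (.list .real)) M)
    (hτ : Computes (a := a) (b := .list .real) τ) :
    Computes (a := a) (b := .list (.list .real))
      fun x => clusterTreeMatrix (n x) (M x) (τ x) :=
  map (b := .prod .nat .nat) (c := .list .real)
    (f := fun x v => (_root_.clusterVertices (n x) (τ x)).map fun w =>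
      bif _root_.isClusterParent (n x) (M x) (τ x) v w then _root_.levelWeight (τ x) v.1
      else bif _root_.isClusterParent (n x) (M x) (τ x) w v then _root_.levelWeight (τ x) w.1
      else (0 : ℕ)) (clusterVertices hn hτ)
    (map (a := .prod a (.prod .nat .nat)) (b := .prod .nat .nat) (c := .real)
      (f := fun p w => bif _root_.isClusterParent (n p.1) (M p.1) (τ p.1) p.2 w then
        _root_.levelWeight (τ p.1) p.2.1
        else bif _root_.isClusterParent (n p.1) (M p.1) (τ p.1) w p.2 then
          _root_.levelWeight (τ p.1) w.1 else (0 : ℕ))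
      (clusterVertices (lift hn) (lift hτ))
      (cond (b := .real)
        (isClusterParent (lift (lift hn)) (lift (lift hM)) (lift (lift hτ)) (lift var) var)
        (levelWeight (lift (lift hτ)) (fst (b := .nat) (lift var)))
        (cond (b := .real)
          (isClusterParent (lift (lift hn)) (lift (lift hM)) (lift (lift hτ)) var (lift var))
          (levelWeight (lift (lift hτ)) (fst (b := .nat) var)) (natCast zero))))

end ClusterTree

section Search

variable {n k L : a.Data → ℕ} {D M : a.Data → List (List ℝ)} {F : a.Data → List (List (List ℝ))}

theorem isDominatingUltrametric (hn : Computes (a := a) (b := .nat) n)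
    (hD : Computes (a := a) (b := .list (.list .real)) D)
    (hM : Computes (a := a) (b := .list (.list .real)) M) :
    Computes (a := a) (b := .bool) fun x => isDominatingUltrametric (n x) (D x) (M x) := by
  refine all (b := .nat) (f := fun x y => _) (range hn)
    (and (realLe (matrixEntry (lift hM) var var) (natCast zero))
      (all (b := .nat) (f := fun p z => _) (range (lift hn))
        (and (and (realLe (matrixEntry (lift (lift hD)) (lift var) var)
            (matrixEntry (lift (lift hM)) (lift var) var))
          (realLe (matrixEntry (lift (lift hM)) (lift var) var)
            (matrixEntry (lift (lift hM)) var (lift var))))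
          (all (b := .nat) (f := fun p z => _) (range (lift (lift hn)))
            (or (realLe (matrixEntry (lift (lift (lift hM))) (lift (lift var)) var)
                (matrixEntry (lift (lift (lift hM))) (lift (lift var)) (lift var)))
              (realLe (matrixEntry (lift (lift (lift hM))) (lift (lift var)) var)
                (matrixEntry (lift (lift (lift hM))) (lift var) var)))))))

theorem isRamseyFamily (hn : Computes (a := a) (b := .nat) n)
    (hL : Computes (a := a) (b := .nat) L)
    (hD : Computes (a := a) (b := .list (.list .real)) D)
    (hF : Computes (a := a) (b := .list (.list (.list .real))) F) :
    Computes (a := a) (b := .bool) fun x => isRamseyFamily (n x) (L x) (D x) (F x) := by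
  refine all (b := .nat) (f := fun x y => _) (range hn)
    (any (b := .list (.list .real)) (f := fun p z => _) (lift hF)
      (all (b := .nat) (f := fun p z => _) (range (lift (lift hn)))
        (realLe (matrixEntry (lift var) (lift (lift var)) var)
          (mul (mul (natCast (const_nat 16)) (natCast (lift (lift (lift hL)))))
            (matrixEntry (lift (lift (lift hD))) (lift (lift var)) var)))))

theorem ramseyFamilies (hk : Computes (a := a) (b := .nat) k)
    (hD : Computes (a := a) (b := .list (.list .real)) D)
    (hL : Computes (a := a) (b := .nat) L) :
    Computes (a := a) (b := .list (.list (.list (.list .real))))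
      fun x => ramseyFamilies (k x) (D x) (L x) := by
  have hn := length (b := .list .real) hD
  exact filter (b := .list (.list (.list .real)))
    (f := fun x F => F.all (_root_.isDominatingUltrametric (D x).length (D x)) &&
      _root_.isRamseyFamily (D x).length (L x) (D x) F)
    (listsOfLength (b := .list (.list .real)) (listsOfLength (b := .list .real)
      (listsOfLength (b := .real) (flatten (b := .real) hD) hn) hn) hk)
    (and (all (a := .prod a (.list (.list (.list .real)))) (b := .list (.list .real))
        (f := fun p => _root_.isDominatingUltrametric (D p.1).length (D p.1)) var
        (isDominatingUltrametric (lift (lift hn)) (lift (lift hD)) var))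
      (isRamseyFamily (lift hn) (lift hL) (lift hD) var))

theorem bestRamseyFamily (hk : Computes (a := a) (b := .nat) k)
    (hD : Computes (a := a) (b := .list (.list .real)) D) :
    Computes (a := a) (b := .list (.list (.list .real)))
      fun x => bestRamseyFamily (k x) (D x) :=
  headD (b := .list (.list (.list .real)))
    (flatMap (b := .nat) (c := .list (.list (.list .real)))
      (f := fun x => _root_.ramseyFamilies (k x) (D x))
      (range (succ (succ (length (b := .list .real) hD))))
      (ramseyFamilies (lift hk) (lift hD) var)) nil

theorem ramseyTreeCover (hk : Computes (a := a) (b := .nat) k)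
    (hD : Computes (a := a) (b := .list (.list .real)) D) :
    Computes (a := a) (b := .list (.list (.list .real)))
      fun x => ramseyTreeCover (k x) (D x) :=
  map (b := .list (.list .real)) (c := .list (.list .real))
    (f := fun x M => _root_.clusterTreeMatrix (D x).length M (_root_.sortedValues M.flatten))
    (bestRamseyFamily hk hD)
    (clusterTreeMatrix (lift (length (b := .list .real) hD)) var
      (sortedValues (flatten (b := .real) var)))

end Search

end Computes

/-! ### Correctness of the search. -/

theorem matrixEntry_ofFn {n : ℕ} (f : Fin n → Fin n → ℝ) (i j : Fin n) :
    matrixEntry (List.ofFn fun i => List.ofFn fun j => f i j) i j = f i j := by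
  simp [matrixEntry]

theorem matrixEntry_mem_flatten {n : ℕ} {M : List (List ℝ)} (hM : M.length = n)
    (hrow : ∀ r ∈ M, r.length = n) {i j : ℕ} (hi : i < n) (hj : j < n) :
    matrixEntry M i j ∈ M.flatten := by
  have hi' : i < M.length := hM.symm ▸ hi
  have hr := List.getElem_mem hi'
  have hj' : j < M[i].length := (hrow _ hr).symm ▸ hj
  rw [matrixEntry, List.getD_eq_getElem _ _ hi', List.getD_eq_getElem _ _ hj']
  exact List.mem_flatten.2 ⟨_, hr, List.getElem_mem hj'⟩

theorem isDominatingUltrametric_eq_true {n : ℕ} {D M : List (List ℝ)} :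
    isDominatingUltrametric n D M = true ↔ ∀ x < n, matrixEntry M x x ≤ 0 ∧
      ∀ y < n, (matrixEntry D x y ≤ matrixEntry M x y ∧ matrixEntry M x y ≤ matrixEntry M y x) ∧
        ∀ z < n, matrixEntry M x z ≤ max (matrixEntry M x y) (matrixEntry M y z) := by
  simp [isDominatingUltrametric]

theorem isRamseyFamily_eq_true {n L : ℕ} {D : List (List ℝ)} {F : List (List (List ℝ))} :
    isRamseyFamily n L D F = true ↔ ∀ u < n, ∃ M ∈ F, ∀ v < n,
      matrixEntry M u v ≤ 16 * L * matrixEntry D u v := by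
  simp [isRamseyFamily]

/-- The first hit of a search over the natural numbers is at most any other hit. -/
theorem headD_flatMap_range {α : Type*} (f : ℕ → List α) (z : α) {L N : ℕ} (hL : L < N)
    (hf : f L ≠ []) : ∃ i ≤ L, ((List.range N).flatMap f).headD z ∈ f i := by
  have hsplit : List.range N = List.range (L + 1) ++ (List.range (N - (L + 1))).map (L + 1 + ·) := by
    rw [← List.range_add]
    congr 1
    omega
  have hne : (List.range (L + 1)).flatMap f ≠ [] := by
    obtain ⟨y, hy⟩ := List.exists_mem_of_ne_nil _ hf
    exact List.ne_nil_of_mem (List.mem_flatMap.2 ⟨L, by simp, hy⟩)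
  rw [hsplit, List.flatMap_append]
  rcases h : (List.range (L + 1)).flatMap f with _ | ⟨y, t⟩
  · exact absurd h hne
  · have hy : y ∈ (List.range (L + 1)).flatMap f := by simp [h]
    obtain ⟨i, hi, hyi⟩ := List.mem_flatMap.1 hy
    rw [List.mem_range] at hi
    exact ⟨i, by omega, by simpa using hyi⟩

section Search

variable {X : Type*} [MetricSpace X] {n : ℕ} (e : Fin n ≃ X)

theorem distMatrix_length : (distMatrix e).length = n := by simp [distMatrix]

theorem matrixEntry_distMatrix {i j : ℕ} (hi : i < n) (hj : j < n) :
    matrixEntry (distMatrix e) i j = dist (e ⟨i, hi⟩) (e ⟨j, hj⟩) :=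
  matrixEntry_ofFn (fun i j => dist (e i) (e j)) ⟨i, hi⟩ ⟨j, hj⟩

theorem mem_flatten_distMatrix {t : ℝ} :
    t ∈ (distMatrix e).flatten ↔ ∃ i j, dist (e i) (e j) = t := by
  simp [distMatrix, List.mem_flatten, List.mem_ofFn]

/-- The family from `exists_ultrametric_cover` is itself a candidate: its field `value` places all
entries in the searched set. -/
theorem ramseyFamilies_ne_nil {k L : ℕ} (hk : 1 ≤ k) (hL : 1 ≤ L)
    (h : (n : ℝ) * Real.log n ^ (k - 1) ≤ (L : ℝ) ^ k) :
    ramseyFamilies k (distMatrix e) L ≠ [] := by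
  obtain ⟨k, rfl⟩ : ∃ m, k = m + 1 := ⟨k - 1, by omega⟩
  have : Fintype X := Fintype.ofEquiv _ e
  have hcard : Fintype.card X = n := by simpa using (Fintype.card_congr e).symm
  obtain ⟨ρ, hρ, hcov⟩ := exists_ultrametric_cover (X := X) hL k Finset.univ
    (by rw [Finset.card_univ, hcard]; simpa using h)
  let F : List (List (List ℝ)) := List.ofFn fun t => List.ofFn fun i => List.ofFn fun j =>
    ρ t (e i) (e j)
  have hent : ∀ t (i j : ℕ) (hi : i < n) (hj : j < n),
      matrixEntry (List.ofFn fun i => List.ofFn fun j => ρ t (e i) (e j)) i j =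
        ρ t (e ⟨i, hi⟩) (e ⟨j, hj⟩) := fun t i j hi hj =>
    matrixEntry_ofFn (fun i j => ρ t (e i) (e j)) ⟨i, hi⟩ ⟨j, hj⟩
  apply List.ne_nil_of_mem (a := F)
  rw [ramseyFamilies, List.mem_filter, distMatrix_length, Bool.and_eq_true, List.all_eq_true,
    isRamseyFamily_eq_true]
  refine ⟨?_, ?_, ?_⟩
  · rw [mem_listsOfLength]
    refine ⟨by simp [F], fun M hM => ?_⟩
    obtain ⟨t, rfl⟩ := List.mem_ofFn.1 hM
    rw [mem_listsOfLength]
    refine ⟨by simp, fun r hr => ?_⟩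
    obtain ⟨i, rfl⟩ := List.mem_ofFn.1 hr
    rw [mem_listsOfLength]
    refine ⟨by simp, fun s hs => ?_⟩
    obtain ⟨j, rfl⟩ := List.mem_ofFn.1 hs
    obtain ⟨D, hD⟩ := hρ t
    obtain ⟨a, b, hab⟩ := hD.value (e i) (Finset.mem_univ _) (e j) (Finset.mem_univ _)
    exact (mem_flatten_distMatrix e).2 ⟨e.symm a, e.symm b, by simp [hab]⟩
  · intro M hM
    obtain ⟨t, rfl⟩ := List.mem_ofFn.1 hM
    obtain ⟨D, hD⟩ := hρ t
    rw [isDominatingUltrametric_eq_true]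
    intro x hx
    refine ⟨?_, fun y hy => ⟨⟨?_, ?_⟩, fun z hz => ?_⟩⟩
    · rw [hent t x x hx hx, hD.self _ (Finset.mem_univ _)]
    · rw [hent t x y hx hy, matrixEntry_distMatrix e hx hy]
      exact hD.dom _ (Finset.mem_univ _) _ (Finset.mem_univ _)
    · rw [hent t x y hx hy, hent t y x hy hx]
      exact (hD.symm _ (Finset.mem_univ _) _ (Finset.mem_univ _)).le
    · rw [hent t x y hx hy, hent t x z hx hz, hent t y z hy hz]
      exact hD.ultra _ (Finset.mem_univ _) _ (Finset.mem_univ _) _ (Finset.mem_univ _)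
  · intro u hu
    obtain ⟨t, ht⟩ := hcov (e ⟨u, hu⟩) (Finset.mem_univ _)
    refine ⟨_, List.mem_ofFn.2 ⟨t, rfl⟩, fun v hv => ?_⟩
    rw [hent t u v hu hv, matrixEntry_distMatrix e hu hv]
    exact ht _

/-- All properties are read off from the tests and the search space, so it does not matter which
family is found. The tests contain only inequalities: the zero diagonal and positivity off it follow
from domination, and symmetry from swapping the indices. -/
theorem bestRamseyFamily_spec {k L : ℕ} (hk : 1 ≤ k) (hL : 1 ≤ L) (hLn : L ≤ n + 1)
    (h : (n : ℝ) * Real.log n ^ (k - 1) ≤ (L : ℝ) ^ k) :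
    (bestRamseyFamily k (distMatrix e)).length = k ∧
      (∀ M ∈ bestRamseyFamily k (distMatrix e), M.length = n ∧ (∀ r ∈ M, r.length = n) ∧
        (∀ t ∈ M.flatten, 0 ≤ t) ∧ IsUltrametricMatrix n M ∧
        ∀ i j : Fin n, dist (e i) (e j) ≤ matrixEntry M i j) ∧
      ∀ u : Fin n, ∃ M ∈ bestRamseyFamily k (distMatrix e), ∀ v : Fin n,
        matrixEntry M u v ≤ 16 * L * dist (e u) (e v) := by
  obtain ⟨L', hL', hmem⟩ := headD_flatMap_range (ramseyFamilies k (distMatrix e)) []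
    (show L < (distMatrix e).length + 2 by rw [distMatrix_length]; omega)
    (ramseyFamilies_ne_nil e hk hL h)
  change bestRamseyFamily k (distMatrix e) ∈ _ at hmem
  rw [ramseyFamilies, List.mem_filter, distMatrix_length, Bool.and_eq_true, List.all_eq_true,
    isRamseyFamily_eq_true, mem_listsOfLength] at hmem
  obtain ⟨⟨hlen, hlists⟩, hultra, hcov⟩ := hmem
  refine ⟨hlen, fun M hM => ?_, fun u => ?_⟩
  · obtain ⟨hrows, hcols⟩ := mem_listsOfLength.1 (hlists M hM)
    have hu := isDominatingUltrametric_eq_true.1 (hultra M hM)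
    have hdom : ∀ i j : Fin n, dist (e i) (e j) ≤ matrixEntry M i j := fun i j => by
      have := ((hu i i.2).2 j j.2).1.1
      rwa [matrixEntry_distMatrix e i.2 j.2] at this
    refine ⟨hrows, fun r hr => (mem_listsOfLength.1 (hcols r hr)).1, ?_, ?_, hdom⟩
    · intro t ht
      obtain ⟨r, hr, htr⟩ := List.mem_flatten.1 ht
      obtain ⟨i, j, rfl⟩ := (mem_flatten_distMatrix e).1
        ((mem_listsOfLength.1 (hcols r hr)).2 t htr)
      exact dist_nonneg
    · refine ⟨fun x hx => ?_, fun x hx y hy => ?_, fun x hx y hy z hz => ?_,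
        fun x hx y hy hxy => ?_⟩
      · exact le_antisymm (hu x hx).1 (dist_nonneg.trans (hdom ⟨x, hx⟩ ⟨x, hx⟩))
      · exact le_antisymm ((hu x hx).2 y hy).1.2 ((hu y hy).2 x hx).1.2
      · exact ((hu x hx).2 y hy).2 z hz
      · refine lt_of_lt_of_le (dist_pos.2 fun h => hxy ?_) (hdom ⟨x, hx⟩ ⟨y, hy⟩)
        simpa using h
  · obtain ⟨M, hM, hv⟩ := hcov u u.2
    refine ⟨M, hM, fun v => ?_⟩
    have := hv v v.2
    rw [matrixEntry_distMatrix e u.2 v.2] at this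
    refine this.trans ?_
    have : (L' : ℝ) ≤ L := by exact_mod_cast hL'
    gcongr

end Search

/-! ### Rounding of the bound, and conclusion. -/

/-- The rounded distortion bound. -/
theorem exists_distortion_bound {n k : ℕ} (hk : 1 ≤ k) :
    ∃ L : ℕ, 1 ≤ L ∧ L ≤ n + 1 ∧ (n : ℝ) * Real.log n ^ (k - 1) ≤ (L : ℝ) ^ k ∧
      (2 ≤ n → (L : ℝ) ≤ 3 * ((n : ℝ) ^ (1 / (k : ℝ)) * Real.log n ^ (1 - 1 / (k : ℝ)))) := by
  have hk0 : (0 : ℝ) < k := by exact_mod_cast hk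
  rcases Nat.lt_or_ge n 2 with hn | hn
  · refine ⟨1, le_rfl, by omega, ?_, fun h => absurd h (by omega)⟩
    interval_cases n
    · simp
    · rcases Nat.eq_zero_or_pos (k - 1) with h | h
      · simp [h]
      · simp [zero_pow h.ne']
  · have hn2 : (2 : ℝ) ≤ n := by exact_mod_cast hn
    have hlog2 : 1 / 2 ≤ Real.log n := by
      have h1 := Real.log_two_gt_d9
      have h2 := Real.log_le_log (by norm_num) hn2
      linarith
    have hlogn : Real.log n ≤ n := Real.log_le_self (by positivity)
    have hexp : 0 ≤ 1 - 1 / (k : ℝ) := by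
      have : 1 / (k : ℝ) ≤ 1 := by
        rw [div_le_one hk0]; exact_mod_cast hk
      linarith
    have hexp' : 0 ≤ 1 / (k : ℝ) := by positivity
    set y := (n : ℝ) ^ (1 / (k : ℝ)) * Real.log n ^ (1 - 1 / (k : ℝ)) with hy
    have hyk : y ^ k = n * Real.log n ^ (k - 1) := by
      rw [hy, mul_pow, ← Real.rpow_natCast, ← Real.rpow_natCast (Real.log n ^ _),
        ← Real.rpow_mul (by linarith), ← Real.rpow_mul (by linarith), one_div_mul_cancel hk0.ne',
        Real.rpow_one, sub_mul, one_mul, one_div_mul_cancel hk0.ne', ← Real.rpow_natCast,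
        Nat.cast_sub hk, Nat.cast_one]
    -- As a weighted geometric mean of `n` and `log n`, both at least `1 / 2` and at most `n`, the
    -- number `y` lies between `1 / 2` and `n`.
    have hylow : 1 / 2 ≤ y := by
      have h1 : (1 / 2 : ℝ) ^ (1 / (k : ℝ)) ≤ (n : ℝ) ^ (1 / (k : ℝ)) :=
        Real.rpow_le_rpow (by norm_num) (by linarith) hexp'
      have h2 : (1 / 2 : ℝ) ^ (1 - 1 / (k : ℝ)) ≤ Real.log n ^ (1 - 1 / (k : ℝ)) :=
        Real.rpow_le_rpow (by norm_num) hlog2 hexp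
      have h3 := mul_le_mul h1 h2 (by positivity) (by positivity)
      rwa [← Real.rpow_add (by norm_num), add_sub_cancel, Real.rpow_one] at h3
    have hyn : y ≤ n := by
      have h2 : Real.log n ^ (1 - 1 / (k : ℝ)) ≤ (n : ℝ) ^ (1 - 1 / (k : ℝ)) :=
        Real.rpow_le_rpow (by linarith) hlogn hexp
      have h3 := mul_le_mul_of_nonneg_left h2 (by positivity : 0 ≤ (n : ℝ) ^ (1 / (k : ℝ)))
      rwa [← Real.rpow_add (by linarith), add_sub_cancel, Real.rpow_one] at h3
    -- The factor `3` comes from `⌈y⌉ < y + 1 ≤ 3 y`, valid as `y ≥ 1 / 2`.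
    refine ⟨⌈y⌉₊, Nat.one_le_ceil_iff.2 (by linarith), (Nat.ceil_le.2 hyn).trans (by omega), ?_,
      fun _ => ?_⟩
    · rw [← hyk]
      exact pow_le_pow_left₀ (by linarith) (Nat.le_ceil y) k
    · have := Nat.ceil_lt_add_one (by linarith : 0 ≤ y)
      linarith

theorem mainTheorem5 :
    ∃ (P : Prog (.prod .nat (.list (.list .real))) (.list (.list (.list .real)))) (C : ℝ),
      0 < C ∧
      ∀ (n k : ℕ), 1 ≤ k → ∀ (X : Type*) [MetricSpace X] (e : Fin n ≃ X),
        ∃ (out : List (List (List ℝ))) (T : Fin k → WeightedTree X),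
          out ∈ P.eval (k, distMatrix e) ∧
          List.Forall₂ (fun tree M => tree.IsAdjacencyMatrix e M) (List.ofFn T) out ∧
          (∀ t, (T t).IsUltrametric) ∧
          IsRamseyTreeCover
            (C * ((n : ℝ) ^ (1 / (k : ℝ)) * Real.log n ^ (1 - 1 / (k : ℝ)))) T := by
  obtain ⟨P, hP⟩ := Computes.ramseyTreeCover (a := .prod .nat (.list (.list .real)))
    (Computes.fst (b := .nat) Computes.id) (Computes.snd (c := .list (.list .real)) Computes.id)
  -- `48 = 16 · 3`: the distortion `16 L` times the rounding factor.
  refine ⟨P, 48, by norm_num, fun n k hk X _ e => ?_⟩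
  obtain ⟨L, hL1, hLn, hLk, hLy⟩ := exists_distortion_bound (n := n) hk
  obtain ⟨hlen, hF, hcov⟩ := bestRamseyFamily_spec e hk hL1 hLn hLk
  have hlt : ∀ {i : ℕ}, i < k → i < (bestRamseyFamily k (distMatrix e)).length :=
    fun h => h.trans_eq hlen.symm
  have hmem : ∀ t : Fin k, (bestRamseyFamily k (distMatrix e))[(t : ℕ)]'(hlt t.2) ∈
      bestRamseyFamily k (distMatrix e) := fun t => List.getElem_mem _
  have hvalue : ∀ M ∈ bestRamseyFamily k (distMatrix e), ∀ x < n, ∀ y < n,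
      matrixEntry M x y ∈ sortedValues M.flatten := fun M hM x hx y hy =>
    mem_sortedValues.2 (matrixEntry_mem_flatten (hF M hM).1 (hF M hM).2.1 hx hy)
  have hτ : ∀ M ∈ bestRamseyFamily k (distMatrix e), 0 < n →
      0 < (sortedValues M.flatten).length := fun M hM hn =>
    List.length_pos_of_mem (hvalue M hM 0 hn 0 hn)
  let T : Fin k → WeightedTree X := fun t =>
    clusterTree e ((bestRamseyFamily k (distMatrix e))[(t : ℕ)]'(hlt t.2)) _ (hτ _ (hmem t))
  have hdist : ∀ t x y, (T t).treeDist x y =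
      matrixEntry ((bestRamseyFamily k (distMatrix e))[(t : ℕ)]'(hlt t.2))
        (e.symm x) (e.symm y) := fun t x y =>
    clusterTree_treeDist e _ (hF _ (hmem t)).2.2.2.1 (pairwise_sortedValues _)
      (fun s hs => (hF _ (hmem t)).2.2.1 s (mem_sortedValues.1 hs)) (hvalue _ (hmem t)) x y
  refine ⟨ramseyTreeCover k (distMatrix e), T, ?_, ?_, fun t x y z => ?_, fun t x y => ?_,
    fun u => ?_⟩
  · rw [hP]
    exact Part.mem_some _
  · rw [List.forall₂_iff_get]
    refine ⟨by simp [ramseyTreeCover, hlen], fun i h₁ h₂ => ?_⟩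
    have hi : i < k := by simpa using h₁
    have h := clusterTree_isAdjacencyMatrix
      (M := (bestRamseyFamily k (distMatrix e))[i]'(hlt hi)) e (hτ _ (hmem ⟨i, hi⟩))
    simpa [ramseyTreeCover, distMatrix_length, T] using h
  · rw [hdist, hdist, hdist]
    exact (hF _ (hmem t)).2.2.2.1.ultra _ (Fin.is_lt _) _ (Fin.is_lt _) _ (Fin.is_lt _)
  · rw [hdist]
    simpa using (hF _ (hmem t)).2.2.2.2 (e.symm x) (e.symm y)
  · obtain ⟨M, hM, hv⟩ := hcov (e.symm u)
    obtain ⟨i, hi, rfl⟩ := List.mem_iff_getElem.1 hM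
    refine ⟨⟨i, hi.trans_eq hlen⟩, fun v => ?_⟩
    rw [hdist]
    have h := hv (e.symm v)
    rw [e.apply_symm_apply, e.apply_symm_apply] at h
    refine h.trans ?_
    -- For `n = 1` and `k > 1` the bound vanishes because `log 1 = 0`, so it can be compared with
    -- `L` only when two distinct points exist; for `u = v` both sides are zero.
    rcases eq_or_ne u v with rfl | huv
    · simp
    · have hn : 2 ≤ n := by
        have h1 : e.symm u ≠ e.symm v := fun h => huv (e.symm.injective h)
        have := (e.symm u).2
        have := (e.symm v).2
        by_contra
        exact h1 (Fin.ext (by omega))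
      have := hLy hn
      refine mul_le_mul_of_nonneg_right ?_ dist_nonneg
      linarith
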